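/- Let $\mathscr H$ be a separable complex Hilbert space and let $H_0$ be the operator on $\ell^2(\mathbb Z,\mathscr H)\cong \ell^2(\mathbb Z)\otimes\mathscr H$ given by $(H_0\phi)(n)=2\phi(n)-\phi(n+1)-\phi(n-1)$. For $s\in\mathbb R$ let $\ell^2_s(\mathbb Z,\mathscr H)$ be the space of sequences $\phi:\mathbb Z\to\mathscr H$ with $\|\phi\|^2=\sum_n e^{s|n|}\|\phi(n)\|^2<\infty$. On $\ell^2(\mathbb Z)$ let $(W_{-\gamma}x)(n)=e^{-\frac{\gamma}{2}|n|}x(n)$ and $(Jx)(n)=(-1)^{|n|}x(n)$, and put $\mathbf J=J\otimes I$. For $\varepsilon>0$ let $D_\varepsilon^*=\{\lambda\in\mathbb C: 0<|\lambda|<\varepsilon\}$. Let $\gamma>0$ and let $V$ be a bounded, not necessarily selfadjoint, operator on $\ell^2(\mathbb Z,\mathscr H)$ satisfying the following assumption. $V=(\Gamma_1\otimes\Lambda_1)\,W\,(\Gamma_2\otimes\Lambda_2)$, where - $(W\phi)(n)=\sum_{m\in\mathbb Z}w(n,m)\phi(m)$ with bounded operators $w(n,m)$ on $\mathscr H$ such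 that $\|w(n,m)\|\,e^{\gamma(|n|+|m|)}\le C$ for all $n,m\in\mathbb Z$ and some constant $C>0$; - $\Gamma_1,\Gamma_2$ are bounded operators on $\ell^2(\mathbb Z)$ that commute with $W_{-\gamma}$ and with $J$; - $\Lambda_1$ is a bounded and $\Lambda_2$ a compact operator on $\mathscr H$, and $\Lambda_2\Lambda_1$ has finite rank. Put $H_V=H_0+V$ and $V_{\mathbf J}=\mathbf J V\mathbf J^{-1}$. Note that $\mathbf J(H_V-z)\mathbf J^{-1}=-(H_{-V_{\mathbf J}}-(4-z))$. Then there is $\varepsilon_0\in(0,\gamma/8]$, independent of $V$, such that the following holds. 1. For $\mathbf V=V$ and for $\mathbf V=-V_{\mathbf J}$, the function $\lambda\mapsto (H_{\mathbf V}-\lambda^2)^{-1}$, with values in the bounded operators from $\ell^2_\gamma(\mathbb Z,\mathscr H)$ to $\ell^2_{-\gamma}(\mathbb Z,\mathscr H)$, has a meromorphic extension from $D_{\varepsilon_0}^*\cap\{\operatorname{Im}\lambda>0\}$ to $D_{\varepsilon_0}^*$. For $\lambda\in D_{\varepsilon_0}^*$, the point $z_0(\lambda)=\lambda^2$ is called a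 resonance of $H_V$ near $0$ if $\lambda$ is a pole of this extension for $\mathbf V=V$, and $z_4(\lambda)=4-\lambda^2$ is called a resonance of $H_V$ near $4$ if $\lambda$ is a pole of this extension for $\mathbf V=-V_{\mathbf J}$. 2. For each $\mu\in\{0,4\}$ there is $r_0\in(0,\varepsilon_0]$ such that, for every $0<r<r_0$, no $\lambda$ with $0<|\lambda|<r$ is such that $z_\mu(\lambda)$ is a resonance of $H_V$. -/

import Mathlib

open Filter Topology
open scoped ENNReal NNReal InnerProductSpace ComplexConjugate

noncomputable section

namespace DiscreteSchrodinger

/-- `ℓ²(ℤ, E)`; in particular `L2Z ℂ = ℓ²(ℤ)`. -/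
abbrev L2Z (E : Type*) [NormedAddCommGroup E] : Type _ := lp (fun _ : ℤ => E) 2

section Diagonal

set_option linter.unusedSectionVars false

variable {E F : Type*} [NormedAddCommGroup E] [NormedSpace ℂ E]
  [NormedAddCommGroup F] [NormedSpace ℂ F]

theorem memℓp_two_of_sum_le {f : ℤ → E} {C : ℝ}
    (h : ∀ s : Finset ℤ, ∑ n ∈ s, ‖f n‖ ^ 2 ≤ C ^ 2) : Memℓp f 2 :=
  memℓp_gen' (C := C ^ 2) fun s => by simpa using h s

theorem norm_le_of_sum_sq_le {f : L2Z E} {C : ℝ} (hC : 0 ≤ C)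
    (h : ∀ s : Finset ℤ, ∑ n ∈ s, ‖f n‖ ^ 2 ≤ C ^ 2) : ‖f‖ ≤ C :=
  lp.norm_le_of_forall_sum_le (by simp) hC fun s => by simpa using h s

theorem sum_sq_le_norm_sq (f : L2Z E) (s : Finset ℤ) : ∑ n ∈ s, ‖f n‖ ^ 2 ≤ ‖f‖ ^ 2 := by
  simpa using lp.sum_rpow_le_norm_rpow (p := 2) (by simp) f s

theorem diagonal_sum_le (T : ℤ → E →L[ℂ] F) (C : ℝ≥0) (hT : ∀ n, ‖T n‖ ≤ C) (φ : L2Z E)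
    (s : Finset ℤ) : ∑ n ∈ s, ‖T n (φ n)‖ ^ 2 ≤ (C * ‖φ‖) ^ 2 := by
  calc ∑ n ∈ s, ‖T n (φ n)‖ ^ 2 ≤ ∑ n ∈ s, (C : ℝ) ^ 2 * ‖φ n‖ ^ 2 := by
        refine Finset.sum_le_sum fun n _ => ?_
        rw [← mul_pow]
        gcongr
        exact (T n).le_of_opNorm_le (hT n) _
    _ = (C : ℝ) ^ 2 * ∑ n ∈ s, ‖φ n‖ ^ 2 := by rw [Finset.mul_sum]
    _ ≤ (C : ℝ) ^ 2 * ‖φ‖ ^ 2 := by gcongr; exact sum_sq_le_norm_sq φ s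
    _ = (C * ‖φ‖) ^ 2 := by ring

/-- The block diagonal operator `(diagonal T φ)(n) = T n (φ n)` for a bounded family `T`. -/
def diagonal (T : ℤ → E →L[ℂ] F) (C : ℝ≥0) (hT : ∀ n, ‖T n‖ ≤ C) : L2Z E →L[ℂ] L2Z F :=
  LinearMap.mkContinuous
    { toFun := fun φ => ⟨fun n => T n (φ n), memℓp_two_of_sum_le (diagonal_sum_le T C hT φ)⟩
      map_add' := fun φ ψ => lp.ext (funext fun n => (T n).map_add (φ n) (ψ n))
      map_smul' := fun c φ => lp.ext (funext fun n => (T n).map_smul c (φ n)) }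
    C fun φ => norm_le_of_sum_sq_le (by positivity) (diagonal_sum_le T C hT φ)

@[simp] theorem diagonal_apply (T : ℤ → E →L[ℂ] F) (C : ℝ≥0) (hT : ∀ n, ‖T n‖ ≤ C) (φ : L2Z E)
    (n : ℤ) : diagonal T C hT φ n = T n (φ n) := rfl

/-- `I ⊗ Λ` : a bounded operator applied in every fibre. -/
def fiberwise (T : E →L[ℂ] F) : L2Z E →L[ℂ] L2Z F := diagonal (fun _ => T) ‖T‖₊ fun _ => le_rfl

@[simp] theorem fiberwise_apply (T : E →L[ℂ] F) (φ : L2Z E) (n : ℤ) :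
    fiberwise T φ n = T (φ n) := rfl

variable (E) in
/-- Multiplication by a function `a` with `|a| ≤ 1`. -/
def mulOp (a : ℤ → ℂ) (ha : ∀ n, ‖a n‖ ≤ 1) : L2Z E →L[ℂ] L2Z E :=
  diagonal (fun n => a n • ContinuousLinearMap.id ℂ E) 1 fun n =>
    (norm_smul_le _ _).trans <| by
      simpa using mul_le_one₀ (ha n) (norm_nonneg _) (ContinuousLinearMap.norm_id_le (𝕜 := ℂ) (E := E))

@[simp] theorem mulOp_apply (a : ℤ → ℂ) (ha : ∀ n, ‖a n‖ ≤ 1) (φ : L2Z E) (n : ℤ) :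
    mulOp E a ha φ n = a n • φ n := rfl

theorem norm_mulOp_le (a : ℤ → ℂ) (ha : ∀ n, ‖a n‖ ≤ 1) : ‖mulOp E a ha‖ ≤ 1 :=
  ContinuousLinearMap.opNorm_le_bound _ zero_le_one fun φ => by
    rw [one_mul]
    refine norm_le_of_sum_sq_le (norm_nonneg φ) fun s => ?_
    refine le_trans (Finset.sum_le_sum fun n _ => ?_) (sum_sq_le_norm_sq φ s)
    rw [mulOp_apply, norm_smul]
    gcongr
    exact mul_le_of_le_one_left (norm_nonneg _) (ha n)

/-- The weight `e^{(s/2)|n|}`. -/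
def weight (s : ℝ) (n : ℤ) : ℂ := (Real.exp (s / 2 * |(n : ℝ)|) : ℝ)

theorem norm_weight (s : ℝ) (n : ℤ) : ‖weight s n‖ = Real.exp (s / 2 * |(n : ℝ)|) := by
  simp only [weight, Complex.norm_real, Real.norm_eq_abs, Real.abs_exp]

theorem norm_weight_neg_le {γ : ℝ} (hγ : 0 ≤ γ) (n : ℤ) : ‖weight (-γ) n‖ ≤ 1 := by
  rw [norm_weight, Real.exp_le_one_iff]
  have := abs_nonneg (n : ℝ)
  nlinarith

theorem weight_neg_mul_weight (s : ℝ) (n : ℤ) : weight (-s) n * weight s n = 1 := by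
  rw [weight, weight, ← Complex.ofReal_mul, ← Real.exp_add]
  simp [neg_div]

/-- The operator `W_{-γ}` on `ℓ²(ℤ)`, `(W_{-γ} x)(n) = e^{-(γ/2)|n|} x(n)`. -/
def expWeightOp (γ : ℝ) (hγ : 0 ≤ γ) : L2Z ℂ →L[ℂ] L2Z ℂ :=
  mulOp ℂ (weight (-γ)) (norm_weight_neg_le hγ)

variable (E) in
/-- `(J φ)(n) = (-1)^{|n|} φ(n)`. On `ℓ²(ℤ, E)` this is the operator `J ⊗ I`. -/
def signOp : L2Z E →L[ℂ] L2Z E := mulOp E (fun n => (-1) ^ n.natAbs) (by simp)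

/-- `J` is its own inverse. -/
theorem signOp_mul_self : signOp E * signOp E = 1 := by
  ext φ n
  simp [signOp, smul_smul, ← mul_pow]

/-! The free operator -/

theorem shift_sum_le (k : ℤ) (φ : L2Z E) (s : Finset ℤ) :
    ∑ n ∈ s, ‖φ (n + k)‖ ^ 2 ≤ (1 * ‖φ‖) ^ 2 := by
  have h := sum_sq_le_norm_sq φ (s.map (addRightEmbedding k))
  rw [Finset.sum_map] at h
  rw [one_mul]
  exact h

/-- The translation `(shift k φ)(n) = φ(n + k)`. -/
def shift (k : ℤ) : L2Z E →L[ℂ] L2Z E :=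
  LinearMap.mkContinuous
    { toFun := fun φ => ⟨fun n => φ (n + k), memℓp_two_of_sum_le (shift_sum_le k φ)⟩
      map_add' := fun _ _ => rfl
      map_smul' := fun _ _ => rfl }
    1 fun φ => norm_le_of_sum_sq_le (by positivity) (shift_sum_le k φ)

@[simp] theorem shift_apply (k : ℤ) (φ : L2Z E) (n : ℤ) : shift k φ n = φ (n + k) := rfl

variable (E) in
/-- The free operator `(H₀ φ)(n) = 2 φ(n) - φ(n+1) - φ(n-1)`. -/
def freeOp : L2Z E →L[ℂ] L2Z E := (2 : ℂ) • 1 - shift 1 - shift (-1)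

theorem freeOp_apply (φ : L2Z E) (n : ℤ) :
    freeOp E φ n = (2 : ℂ) • φ n - φ (n + 1) - φ (n - 1) := rfl

end Diagonal

section Tensor

variable {H : Type*} [NormedAddCommGroup H] [InnerProductSpace ℂ H]

/-- The scalar sequence `m ↦ ⟪u, φ(m)⟫`. -/
def coord (u : H) : L2Z H →L[ℂ] L2Z ℂ := fiberwise (innerSL ℂ u)

@[simp] theorem coord_apply (u : H) (φ : L2Z H) (n : ℤ) : coord u φ n = ⟪u, φ n⟫_ℂ := rfl

theorem norm_coord_le (u : H) (φ : L2Z H) : ‖coord u φ‖ ≤ ‖u‖ * ‖φ‖ :=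
  norm_le_of_sum_sq_le (by positivity) fun s => by
    simpa using diagonal_sum_le (fun _ => innerSL ℂ u) ‖innerSL ℂ u‖₊ (fun _ => le_rfl) φ s

theorem norm_apply_coord_le (Γ : L2Z ℂ →L[ℂ] L2Z ℂ) (φ : L2Z H) (n : ℤ) (u : H) :
    ‖Γ (coord u φ) n‖ ≤ ‖Γ‖ * ‖φ‖ * ‖u‖ :=
  calc ‖Γ (coord u φ) n‖ ≤ ‖Γ (coord u φ)‖ := lp.norm_apply_le_norm (by simp) _ _
    _ ≤ ‖Γ‖ * ‖coord u φ‖ := Γ.le_opNorm _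
    _ ≤ ‖Γ‖ * (‖u‖ * ‖φ‖) := by gcongr; exact norm_coord_le u φ
    _ = ‖Γ‖ * ‖φ‖ * ‖u‖ := by ring

/-- The functional `u ↦ conj ((Γ ⟪u, φ(·)⟫)(n))`. -/
def ampFunctional (Γ : L2Z ℂ →L[ℂ] L2Z ℂ) (φ : L2Z H) (n : ℤ) : H →L[ℂ] ℂ :=
  LinearMap.mkContinuous
    { toFun := fun u => conj (Γ (coord u φ) n)
      map_add' := fun u v => by
        have : coord (u + v) φ = coord u φ + coord v φ :=
          lp.ext (funext fun m => inner_add_left u v (φ m))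
        rw [this, map_add, lp.coeFn_add, Pi.add_apply, map_add]
      map_smul' := fun c u => by
        have : coord (c • u) φ = conj c • coord u φ :=
          lp.ext (funext fun m => inner_smul_left u (φ m) c)
        rw [this, map_smul, lp.coeFn_smul, Pi.smul_apply, smul_eq_mul, map_mul, Complex.conj_conj]
        rfl }
    (‖Γ‖ * ‖φ‖) fun u => by
      simpa using norm_apply_coord_le Γ φ n u

variable [CompleteSpace H]

/-- The value at `n` of `(Γ ⊗ I) φ`: the vector with `⟪u, ·⟫ = (Γ ⟪u, φ(·)⟫)(n)` for all `u`. -/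
def ampValue (Γ : L2Z ℂ →L[ℂ] L2Z ℂ) (φ : L2Z H) (n : ℤ) : H :=
  (InnerProductSpace.toDual ℂ H).symm (ampFunctional Γ φ n)

theorem inner_ampValue (Γ : L2Z ℂ →L[ℂ] L2Z ℂ) (φ : L2Z H) (n : ℤ) (u : H) :
    ⟪u, ampValue Γ φ n⟫_ℂ = Γ (coord u φ) n := by
  rw [← inner_conj_symm, ampValue, InnerProductSpace.toDual_symm_apply]
  exact Complex.conj_conj _

theorem ampValue_sum_le (Γ : L2Z ℂ →L[ℂ] L2Z ℂ) (φ : L2Z H) (s : Finset ℤ) :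
    ∑ n ∈ s, ‖ampValue Γ φ n‖ ^ 2 ≤ (‖Γ‖ * ‖φ‖) ^ 2 := by
  classical
  let K : Submodule ℂ H := Submodule.span ℂ (s.image (ampValue Γ φ) : Set H)
  have : FiniteDimensional ℂ K := FiniteDimensional.span_finset ℂ _
  let b := stdOrthonormalBasis ℂ K
  have hb : Orthonormal ℂ (fun j => (b j : H)) :=
    b.orthonormal.comp_linearIsometry K.subtypeₗᵢ
  have hφ : ∑ j, ‖coord (b j : H) φ‖ ^ 2 ≤ ‖φ‖ ^ 2 := by
    have h1 : ∀ j, HasSum (fun m => ‖⟪(b j : H), φ m⟫_ℂ‖ ^ 2) (‖coord (b j : H) φ‖ ^ 2) := by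
      intro j
      simpa using lp.hasSum_norm (p := 2) (by simp) (coord (b j : H) φ)
    have h2 : HasSum (fun m => ‖φ m‖ ^ 2) (‖φ‖ ^ 2) := by
      simpa using lp.hasSum_norm (p := 2) (by simp) φ
    exact hasSum_le (fun m => hb.sum_inner_products_le (φ m)) (hasSum_sum fun j _ => h1 j) h2
  calc ∑ n ∈ s, ‖ampValue Γ φ n‖ ^ 2
      = ∑ n ∈ s, ∑ j, ‖Γ (coord (b j : H) φ) n‖ ^ 2 := by
        refine Finset.sum_congr rfl fun n hn => ?_
        have hmem : ampValue Γ φ n ∈ K :=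
          Submodule.subset_span (Finset.mem_coe.2 (Finset.mem_image_of_mem _ hn))
        have := b.sum_sq_norm_inner_right ⟨ampValue Γ φ n, hmem⟩
        simp only [Submodule.coe_inner, inner_ampValue] at this
        exact this.symm
    _ = ∑ j, ∑ n ∈ s, ‖Γ (coord (b j : H) φ) n‖ ^ 2 := Finset.sum_comm
    _ ≤ ∑ j, (‖Γ‖ * ‖coord (b j : H) φ‖) ^ 2 := by
        refine Finset.sum_le_sum fun j _ => (sum_sq_le_norm_sq _ s).trans ?_
        gcongr
        exact Γ.le_opNorm _
    _ = ‖Γ‖ ^ 2 * ∑ j, ‖coord (b j : H) φ‖ ^ 2 := by simp only [mul_pow, Finset.mul_sum]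
    _ ≤ ‖Γ‖ ^ 2 * ‖φ‖ ^ 2 := by gcongr
    _ = (‖Γ‖ * ‖φ‖) ^ 2 := by ring

/-- `Γ ⊗ I` on `ℓ²(ℤ, H) ≅ ℓ²(ℤ) ⊗ H`. -/
def ampliation (Γ : L2Z ℂ →L[ℂ] L2Z ℂ) : L2Z H →L[ℂ] L2Z H :=
  LinearMap.mkContinuous
    { toFun := fun φ => ⟨ampValue Γ φ, memℓp_two_of_sum_le (ampValue_sum_le Γ φ)⟩
      map_add' := fun φ ψ => lp.ext <| funext fun n => ext_inner_left ℂ fun u => by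
        change ⟪u, ampValue Γ (φ + ψ) n⟫_ℂ = ⟪u, ampValue Γ φ n + ampValue Γ ψ n⟫_ℂ
        simp [inner_ampValue]
      map_smul' := fun c φ => lp.ext <| funext fun n => ext_inner_left ℂ fun u => by
        change ⟪u, ampValue Γ (c • φ) n⟫_ℂ = ⟪u, c • ampValue Γ φ n⟫_ℂ
        simp [inner_ampValue] }
    ‖Γ‖ fun φ => norm_le_of_sum_sq_le (by positivity) (ampValue_sum_le Γ φ)

theorem inner_ampliation_apply (Γ : L2Z ℂ →L[ℂ] L2Z ℂ) (φ : L2Z H) (n : ℤ) (u : H) :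
    ⟪u, ampliation Γ φ n⟫_ℂ = Γ (coord u φ) n :=
  inner_ampValue Γ φ n u

/-- `Γ ⊗ Λ` on `ℓ²(ℤ, H) ≅ ℓ²(ℤ) ⊗ H`. -/
def tensorOp (Γ : L2Z ℂ →L[ℂ] L2Z ℂ) (Λ : H →L[ℂ] H) : L2Z H →L[ℂ] L2Z H :=
  ampliation Γ * fiberwise Λ

/-- The elementary tensor `x ⊗ u`, i.e. the sequence `n ↦ x(n) u`. -/
def elemTensor (x : L2Z ℂ) (u : H) : L2Z H :=
  fiberwise ((ContinuousLinearMap.id ℂ ℂ).smulRight u) x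

/-- The defining property `(Γ ⊗ Λ)(x ⊗ u) = (Γ x) ⊗ (Λ u)`. -/
theorem tensorOp_elemTensor (Γ : L2Z ℂ →L[ℂ] L2Z ℂ) (Λ : H →L[ℂ] H) (x : L2Z ℂ) (u : H) :
    tensorOp Γ Λ (elemTensor x u) = elemTensor (Γ x) (Λ u) := by
  refine lp.ext <| funext fun n => ext_inner_left ℂ fun v => ?_
  have h : coord v (fiberwise Λ (elemTensor x u)) = ⟪v, Λ u⟫_ℂ • x := by
    refine lp.ext <| funext fun m => ?_
    simp [elemTensor, mul_comm]
  change ⟪v, ampliation Γ (fiberwise Λ (elemTensor x u)) n⟫_ℂ = _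
  rw [inner_ampliation_apply, h, map_smul]
  simp [elemTensor, inner_smul_right, mul_comm]

/-- `W` is the operator on `ℓ²(ℤ, H)` with matrix `w`: `(W φ)(n) = ∑ₘ w(n, m) φ(m)`. -/
def IsMatrixOperator (w : ℤ → ℤ → H →L[ℂ] H) (W : L2Z H →L[ℂ] L2Z H) : Prop :=
  ∀ (φ : L2Z H) (n : ℤ), HasSum (fun m => w n m (φ m)) (W φ n)

/-- The standing assumption on the perturbation, with decay rate `γ`:
`V = (Γ₁ ⊗ Λ₁) W (Γ₂ ⊗ Λ₂)`, where `W` has the matrix `w` with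
`‖w(n, m)‖ e^{γ(|n| + |m|)} ≤ C`, the `Γⱼ` commute with `W_{-γ}` and `J`, `Λ₂` is compact and
`Λ₂ Λ₁` has finite rank. -/
def IsAdmissible (γ : ℝ) (hγ : 0 < γ) (V : L2Z H →L[ℂ] L2Z H) : Prop :=
  ∃ (Γ₁ Γ₂ : L2Z ℂ →L[ℂ] L2Z ℂ) (Λ₁ Λ₂ : H →L[ℂ] H)
    (w : ℤ → ℤ → H →L[ℂ] H) (W : L2Z H →L[ℂ] L2Z H),
    V = tensorOp Γ₁ Λ₁ * W * tensorOp Γ₂ Λ₂ ∧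
    IsMatrixOperator w W ∧
    Commute Γ₁ (expWeightOp γ hγ.le) ∧ Commute Γ₁ (signOp ℂ) ∧
    Commute Γ₂ (expWeightOp γ hγ.le) ∧ Commute Γ₂ (signOp ℂ) ∧
    IsCompactOperator Λ₂ ∧
    FiniteDimensional ℂ (LinearMap.range (Λ₂ * Λ₁ : H →L[ℂ] H).toLinearMap) ∧
    ∃ C : ℝ, 0 < C ∧
      ∀ n m : ℤ, ‖w n m‖ * Real.exp (γ * (|(n : ℝ)| + |(m : ℝ)|)) ≤ C

end Tensor

section Weighted

variable (s : ℝ) (E : Type*) [NormedAddCommGroup E] [NormedSpace ℂ E]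

/-- The sequences `f : ℤ → E` with `∑ₙ e^{s|n|} ‖f(n)‖² < ∞`. -/
def weightedSubmodule : Submodule ℂ (ℤ → E) where
  carrier := {f | Memℓp (fun n => weight s n • f n) 2}
  add_mem' {f g} hf hg := by
    have : (fun n => weight s n • (f + g) n)
        = (fun n => weight s n • f n) + fun n => weight s n • g n := by
      funext n
      exact smul_add (weight s n) (f n) (g n)
    change Memℓp (fun n => weight s n • (f + g) n) 2
    rw [this]
    exact Memℓp.add hf hg
  zero_mem' := by
    have : (fun n => weight s n • (0 : ℤ → E) n) = 0 := by
      funext n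
      exact smul_zero (weight s n)
    change Memℓp (fun n => weight s n • (0 : ℤ → E) n) 2
    rw [this]
    exact zero_memℓp
  smul_mem' c f hf := by
    have : (fun n => weight s n • (c • f) n) = c • fun n => weight s n • f n := by
      funext n
      exact smul_comm (weight s n) c (f n)
    change Memℓp (fun n => weight s n • (c • f) n) 2
    rw [this]
    exact Memℓp.const_smul hf c

/-- The weighted space `ℓ²_s(ℤ, E)`, of the sequences with `∑ₙ e^{s|n|} ‖f(n)‖² < ∞`. Its norm is
`(∑ₙ e^{s|n|} ‖f(n)‖²)^{1/2}`, see below. -/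
def WeightedL2Z : Type _ := weightedSubmodule s E

namespace WeightedL2Z

instance : AddCommGroup (WeightedL2Z s E) := inferInstanceAs (AddCommGroup (weightedSubmodule s E))

instance : Module ℂ (WeightedL2Z s E) := inferInstanceAs (Module ℂ (weightedSubmodule s E))

instance : CoeFun (WeightedL2Z s E) fun _ => ℤ → E := ⟨fun f => f.1⟩

/-- Multiplication by the weight, `f ↦ (e^{(s/2)|n|} f(n))ₙ`, from `ℓ²_s(ℤ, E)` to `ℓ²(ℤ, E)`. -/
def toL2Z : WeightedL2Z s E →ₗ[ℂ] L2Z E where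
  toFun f := ⟨fun n => weight s n • f n, f.2⟩
  map_add' f g := lp.ext <| funext fun n => smul_add (weight s n) (f n) (g n)
  map_smul' c f := lp.ext <| funext fun n => smul_comm (weight s n) c (f n)

variable {s E}

@[simp] theorem toL2Z_apply (f : WeightedL2Z s E) (n : ℤ) :
    toL2Z s E f n = weight s n • f n := rfl

theorem toL2Z_injective : Function.Injective (toL2Z s E) := fun f g h => by
  refine Subtype.ext (funext fun n => ?_)
  have h1 : weight s n • f n = weight s n • g n := congrArg (fun φ : L2Z E => φ n) h
  have h2 := congrArg (weight (-s) n • ·) h1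
  simpa only [smul_smul, weight_neg_mul_weight, one_smul] using h2

variable (s E)

instance : NormedAddCommGroup (WeightedL2Z s E) :=
  NormedAddCommGroup.induced _ _ (toL2Z s E) toL2Z_injective

instance : NormedSpace ℂ (WeightedL2Z s E) := NormedSpace.induced ℂ _ _ (toL2Z s E)

theorem norm_toL2Z (f : WeightedL2Z s E) : ‖toL2Z s E f‖ = ‖f‖ := rfl

theorem hasSum_norm_sq (f : WeightedL2Z s E) :
    HasSum (fun n : ℤ => Real.exp (s * |(n : ℝ)|) * ‖f n‖ ^ 2) (‖f‖ ^ 2) := by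
  have h := lp.hasSum_norm (p := 2) (by simp) (toL2Z s E f)
  have e : ∀ n : ℤ, Real.exp (s / 2 * |(n : ℝ)|) ^ 2 = Real.exp (s * |(n : ℝ)|) := fun n => by
    rw [← Real.exp_nat_mul]; congr 1; push_cast; ring
  simpa [norm_smul, norm_weight, mul_pow, e, norm_toL2Z] using h

variable {γ : ℝ} (hγ : 0 ≤ γ)

/-- The inclusion `ℓ²_γ(ℤ, E) ⊂ ℓ²(ℤ, E)`, for `γ ≥ 0`. -/
def inclOfPos : WeightedL2Z γ E →L[ℂ] L2Z E :=
  mulOp E (weight (-γ)) (norm_weight_neg_le hγ) ∘L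
    LinearMap.mkContinuous (toL2Z γ E) 1 fun f => by rw [one_mul]; exact (norm_toL2Z γ E f).le

@[simp] theorem inclOfPos_apply (f : WeightedL2Z γ E) (n : ℤ) : inclOfPos E hγ f n = f n := by
  change weight (-γ) n • weight γ n • f n = f n
  rw [smul_smul, weight_neg_mul_weight, one_smul]

/-- The inclusion `ℓ²(ℤ, E) ⊂ ℓ²_{-γ}(ℤ, E)`, for `γ ≥ 0`. -/
def inclToNeg : L2Z E →L[ℂ] WeightedL2Z (-γ) E :=
  LinearMap.mkContinuous
    { toFun := fun φ => ⟨φ, (mulOp E (weight (-γ)) (norm_weight_neg_le hγ) φ).2⟩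
      map_add' := fun _ _ => rfl
      map_smul' := fun _ _ => rfl }
    1 fun φ => by
      rw [← norm_toL2Z]
      change ‖mulOp E (weight (-γ)) (norm_weight_neg_le hγ) φ‖ ≤ 1 * ‖φ‖
      exact (mulOp E _ _).le_of_opNorm_le (norm_mulOp_le _ _) φ

@[simp] theorem inclToNeg_apply (φ : L2Z E) (n : ℤ) : inclToNeg E hγ φ n = φ n := rfl

end WeightedL2Z

end Weighted

section Resonances

variable {H : Type*} [NormedAddCommGroup H] [InnerProductSpace ℂ H]

/-- The perturbed operator `H_V = H₀ + V`. -/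
def perturbedOp (V : L2Z H →L[ℂ] L2Z H) : L2Z H →L[ℂ] L2Z H := freeOp H + V

/-- The resolvent `(H_V - z)⁻¹` as an operator from `ℓ²_γ(ℤ, H)` to `ℓ²_{-γ}(ℤ, H)`
(meaningful for `z` in the resolvent set of `H_V`). -/
def weightedResolvent (γ : ℝ) (hγ : 0 < γ) (V : L2Z H →L[ℂ] L2Z H) (z : ℂ) :
    WeightedL2Z γ H →L[ℂ] WeightedL2Z (-γ) H :=
  WeightedL2Z.inclToNeg H hγ.le ∘L Ring.inverse (perturbedOp V - z • 1) ∘L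
    WeightedL2Z.inclOfPos H hγ.le

/-- The punctured disk `{λ : 0 < |λ| < ε}`. -/
def puncturedDisk (ε : ℝ) : Set ℂ := Metric.ball 0 ε \ {0}

/-- `R` is a meromorphic extension of `λ ↦ (H_V - λ²)⁻¹ ∈ B(ℓ²_γ, ℓ²_{-γ})` from the upper half
`{0 < |λ| < ε, Im λ > 0}` to the whole punctured disk `{0 < |λ| < ε}`. -/
structure IsMeromorphicExtension (γ : ℝ) (hγ : 0 < γ) (V : L2Z H →L[ℂ] L2Z H) (ε : ℝ)
    (R : ℂ → WeightedL2Z γ H →L[ℂ] WeightedL2Z (-γ) H) : Prop where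
  meromorphicOn : MeromorphicOn R (puncturedDisk ε)
  eq_resolvent : ∀ l ∈ puncturedDisk ε, 0 < l.im → l ^ 2 ∈ resolventSet ℂ (perturbedOp V) →
    R l = weightedResolvent γ hγ V (l ^ 2)

/-- `l` is a pole of a meromorphic extension of `λ ↦ (H_V - λ²)⁻¹` to `{0 < |λ| < ε}`. -/
def IsPoleOfExtension (γ : ℝ) (hγ : 0 < γ) (V : L2Z H →L[ℂ] L2Z H) (ε : ℝ) (l : ℂ) : Prop :=
  l ∈ puncturedDisk ε ∧ ∃ R, IsMeromorphicExtension γ hγ V ε R ∧ meromorphicOrderAt R l < 0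

/-- `V_J = J V J⁻¹` (recall `J⁻¹ = J`). -/
def conjSign (V : L2Z H →L[ℂ] L2Z H) : L2Z H →L[ℂ] L2Z H := signOp H * V * signOp H

theorem signOp_mul_freeOp_mul_signOp :
    signOp H * freeOp H * signOp H = (4 : ℂ) • 1 - freeOp H := by
  refine ContinuousLinearMap.ext fun φ => lp.ext <| funext fun n => ?_
  have h0 : ((-1 : ℂ) ^ n.natAbs) * (-1) ^ n.natAbs = 1 := by simp [← mul_pow]
  have h1 : ((-1 : ℂ) ^ n.natAbs) * (-1) ^ (n + 1).natAbs = -1 := by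
    rw [← pow_add]; exact Odd.neg_one_pow (by grind)
  have h2 : ((-1 : ℂ) ^ n.natAbs) * (-1) ^ (n - 1).natAbs = -1 := by
    rw [← pow_add]; exact Odd.neg_one_pow (by grind)
  change ((-1 : ℂ) ^ n.natAbs) • ((2 : ℂ) • ((-1 : ℂ) ^ n.natAbs • φ n)
    - (-1 : ℂ) ^ (n + 1).natAbs • φ (n + 1) - (-1 : ℂ) ^ (n - 1).natAbs • φ (n - 1))
    = (4 : ℂ) • φ n - ((2 : ℂ) • φ n - φ (n + 1) - φ (n - 1))
  generalize φ n = x, φ (n + 1) = y, φ (n - 1) = z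
  rw [smul_sub, smul_sub, smul_comm _ (2 : ℂ), smul_smul _ _ x, smul_smul _ _ y, smul_smul _ _ z,
    h0, h1, h2]
  module

/-- `J (H_V - z) J⁻¹ = -(H_{-V_J} - (4 - z))`: conjugation by `J` exchanges the two thresholds. -/
theorem conjSign_perturbedOp (V : L2Z H →L[ℂ] L2Z H) (z : ℂ) :
    conjSign (perturbedOp V - z • 1) = -(perturbedOp (-conjSign V) - (4 - z) • 1) := by
  simp only [conjSign, perturbedOp, mul_sub, mul_add, sub_mul, add_mul,
    signOp_mul_freeOp_mul_signOp, mul_smul_comm, smul_mul_assoc, mul_one, signOp_mul_self]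
  module

/-- The two spectral thresholds, `0` and `4`. -/
inductive Threshold : Type
  | zero
  | four

/-- The perturbation that governs the given threshold: `V` at `0`, and `-V_J` at `4`, where
`J (H_V - z) J⁻¹ = -(H_{-V_J} - (4 - z))` turns `z` near `4` into `u = 4 - z` near `0`. -/
def Threshold.perturbation : Threshold → (L2Z H →L[ℂ] L2Z H) → (L2Z H →L[ℂ] L2Z H)
  | .zero, V => V
  | .four, V => -conjSign V

/-- The point `z_μ(l)` is a resonance of `H_V`, where `z₀(l) = l²` and `z₄(l) = 4 - l²`, and
`l ∈ {0 < |l| < ε}` is the coordinate on the two-sheeted surface over a neighbourhood of `μ`.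
For `μ = 4` this says that `z₄(l) = 4 - u` for a pole `u = l²` of the extension of
`(H_{-V_J} - u)⁻¹`. -/
def IsResonance (γ : ℝ) (hγ : 0 < γ) (V : L2Z H →L[ℂ] L2Z H) (ε : ℝ) (μ : Threshold) (l : ℂ) :
    Prop :=
  IsPoleOfExtension γ hγ (μ.perturbation V) ε l

end Resonances

end DiscreteSchrodinger

end

noncomputable section

namespace DiscreteSchrodinger

/-! ### Meromorphic operator families and an analytic Fredholm theorem -/

section Meromorphic

variable {E F G : Type*} [NormedAddCommGroup E] [NormedSpace ℂ E] [NormedAddCommGroup F]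
  [NormedSpace ℂ F] [NormedAddCommGroup G] [NormedSpace ℂ G]

/-! Resonances cannot accumulate at a threshold because, in a suitable variable, the continued
resolvent is meromorphic at the threshold itself, and a function meromorphic at a point is analytic
on a punctured neighbourhood of it.

The variable is `w`, with `z = 2 - w - w⁻¹`; near `z = 0` it is `w = phase l` with `l ^ 2 = z`. The
weighted free resolvent has entries `e^{-γ|n|/2} e^{-γ|m|/2} w^{|n-m|+1} / (1 - w²)`. The weights
beat the growth of `w^{|n-m|}` slightly outside the unit circle, so it continues to a disk
containing both `w = 0` and `w = 1`, and its only singularity there is a simple pole at `w = 1`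
(`regCoeff_add`, `norm_regCoeff_le`).

The weights are split off from the matrix of `V` and moved past the outer factors `A = Γ₁ ⊗ Λ₁` and
`B = Γ₂ ⊗ Λ₂`, which commute with them. Inverting `H_V - z` then reduces to inverting `1 + K(w)`,
where `K = B T A W` and `T` is the continued free resolvent (`perturbed_resolvent`).

The polar part and the matrix units in `T` act as the identity on the fibre and may have infinite
rank. Between `B` and `A`, however, they produce the factor `Λ₂ Λ₁` and become finite rank
(`finiteDimensional_range_sandwich`). Hence `K` is a small analytic family plus a finite rank
meromorphic one, even across `w = 1`. Since `K(0) = 0`, the meromorphic Fredholm theorem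
`meromorphicOn_inverse_one_add` makes `(1 + K)⁻¹` meromorphic on the whole disk, including `w = 1`.

Any other meromorphic extension agrees with this one by the identity theorem on the punctured disk,
so its poles are the same. The threshold `4` reduces to `0` by conjugation with `J`, which preserves
the assumption on `V` (`IsAdmissible.neg_conjSign`). -/

theorem meromorphicAt_bilinear (B : E →L[ℂ] F →L[ℂ] G) {f : ℂ → E} {g : ℂ → F} {x : ℂ}
    (hf : MeromorphicAt f x) (hg : MeromorphicAt g x) :
    MeromorphicAt (fun z => B (f z) (g z)) x := by
  obtain ⟨m, hm⟩ := hf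
  obtain ⟨n, hn⟩ := hg
  refine ⟨m + n, ?_⟩
  have h := (B.analyticAt_bilinear (((x - x) ^ m • f x), ((x - x) ^ n • g x))).comp₂ hm hn
  refine h.congr (Eventually.of_forall fun z => ?_)
  simp [pow_add, smul_smul, mul_comm]

theorem meromorphicAt_clm_comp (T : E →L[ℂ] F) {f : ℂ → E} {x : ℂ} (hf : MeromorphicAt f x) :
    MeromorphicAt (fun z => T (f z)) x := by
  obtain ⟨m, hm⟩ := hf
  refine ⟨m, ((T.analyticAt _).comp hm).congr (Eventually.of_forall fun z => ?_)⟩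
  simp

theorem meromorphicAt_smul_const {c : ℂ → ℂ} {x : ℂ} (hc : MeromorphicAt c x) (v : E) :
    MeromorphicAt (fun z => c z • v) x :=
  hc.smul (MeromorphicAt.const _ _)

theorem MeromorphicAt.clm_comp {f : ℂ → F →L[ℂ] G} {g : ℂ → E →L[ℂ] F} {x : ℂ}
    (hf : MeromorphicAt f x) (hg : MeromorphicAt g x) :
    MeromorphicAt (fun z => f z ∘L g z) x :=
  meromorphicAt_bilinear (ContinuousLinearMap.compL ℂ E F G) hf hg

/-- `1 + A B` is invertible if `1 + B A` is, with inverse `1 - A (1 + B A)⁻¹ B`. -/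
theorem isUnit_one_add_comp_comm (A : F →L[ℂ] E) (B : E →L[ℂ] F)
    (h : IsUnit (1 + B ∘L A : F →L[ℂ] F)) :
    IsUnit (1 + A ∘L B : E →L[ℂ] E) ∧
      Ring.inverse (1 + A ∘L B : E →L[ℂ] E) = 1 - A ∘L Ring.inverse (1 + B ∘L A) ∘L B := by
  set D : F →L[ℂ] F := Ring.inverse (1 + B ∘L A)
  have h1 : (1 + B ∘L A) * D = 1 := Ring.mul_inverse_cancel _ h
  have h2 : D * (1 + B ∘L A) = 1 := Ring.inverse_mul_cancel _ h
  have e1 : ∀ x, D x + B (A (D x)) = x := fun x => by simpa using congrArg (fun T => T x) h1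
  have e2 : ∀ x, D x + D (B (A x)) = x := fun x => by
    simpa [map_add] using congrArg (fun T => T x) h2
  have m1 : (1 + A ∘L B) * (1 - A ∘L D ∘L B) = 1 := by
    ext x
    have h := congrArg A (e1 (B x))
    rw [map_add] at h
    change (x - A (D (B x))) + A (B (x - A (D (B x)))) = x
    rw [map_sub, map_sub, ← h]
    abel
  have m2 : (1 - A ∘L D ∘L B) * (1 + A ∘L B) = 1 := by
    ext x
    have h := congrArg A (e2 (B x))
    rw [map_add] at h
    change (x + A (B x)) - A (D (B (x + A (B x)))) = x
    rw [map_add, map_add, map_add, h, add_sub_cancel_right]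
  let u : (E →L[ℂ] E)ˣ := ⟨_, _, m1, m2⟩
  exact ⟨u.isUnit, Ring.inverse_unit u⟩

theorem meromorphicAt_matrix_det {n : Type*} [Fintype n] [DecidableEq n] {M : ℂ → Matrix n n ℂ}
    {x : ℂ} (hM : ∀ i j, MeromorphicAt (fun z => M z i j) x) :
    MeromorphicAt (fun z => (M z).det) x := by
  simp only [Matrix.det_apply']
  exact MeromorphicAt.fun_sum fun σ _ => (MeromorphicAt.const _ _).mul
    (MeromorphicAt.fun_prod fun i _ => hM _ _)

/-- Cramer's rule: each entry is a minor, itself a determinant of meromorphic entries, times the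
inverse of the determinant. With inverses set to zero at singular matrices the formula holds at
every point. -/
theorem meromorphicAt_matrix_inv {n : Type*} [Fintype n] [DecidableEq n] {M : ℂ → Matrix n n ℂ}
    {x : ℂ} (hM : ∀ i j, MeromorphicAt (fun z => M z i j) x) (i j : n) :
    MeromorphicAt (fun z => (M z)⁻¹ i j) x := by
  simp only [Matrix.inv_def, Ring.inverse_eq_inv', Matrix.smul_apply, Matrix.adjugate_apply,
    smul_eq_mul]
  refine (meromorphicAt_matrix_det hM).inv.mul (meromorphicAt_matrix_det fun k l => ?_)
  by_cases h : k = j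
  · subst h
    simp
  · simpa [Matrix.updateRow_ne h] using hM k l

/-- A meromorphic family of endomorphisms of a finite dimensional space, invertible at one point
of a connected open set, has a meromorphic inverse. -/
theorem meromorphicOn_inverse_of_finiteDimensional [FiniteDimensional ℂ E] {U : Set ℂ}
    (hU : IsPreconnected U) {M : ℂ → E →L[ℂ] E} (hM : MeromorphicOn M U)
    {z₀ : ℂ} (hz₀ : z₀ ∈ U) (hc : ContinuousAt M z₀) (hu : IsUnit (M z₀)) :
    MeromorphicOn (fun z => Ring.inverse (M z)) U ∧ ∀ z ∈ U, ∀ᶠ w in 𝓝[≠] z, IsUnit (M w) := by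
  have : CompleteSpace E := FiniteDimensional.complete ℂ E
  let b := Module.finBasis ℂ E
  let e₁ : (E →L[ℂ] E) ≃+* Module.End ℂ E :=
    { (LinearMap.toContinuousLinearMap (𝕜 := ℂ) (E := E) (F' := E)).symm with
      map_mul' := fun _ _ => rfl }
  let e : (E →L[ℂ] E) ≃+* Matrix _ _ ℂ := e₁.trans (LinearMap.toMatrixAlgEquiv b).toRingEquiv
  have he : ∀ T i j, e T i j = b.coord i (T (b j)) := fun T i j => by
    simp [e, e₁, LinearMap.toMatrixAlgEquiv_apply]
  have hsmul : ∀ (c : ℂ) T, e.symm (c • T) = c • e.symm T := fun c T => by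
    apply e.injective
    ext i j
    rw [RingEquiv.apply_symm_apply, he]
    simp only [_root_.smul_apply, map_smul, Matrix.smul_apply]
    rw [← he, RingEquiv.apply_symm_apply]
  let entry : _ → _ → (E →L[ℂ] E) →L[ℂ] ℂ := fun i j =>
    (LinearMap.toContinuousLinearMap (b.coord i)) ∘L (ContinuousLinearMap.apply ℂ E (b j))
  have hent : ∀ T i j, e T i j = entry i j T := he
  have hmer : ∀ z ∈ U, ∀ i j, MeromorphicAt (fun z => e (M z) i j) z := fun z hz i j => by
    simp only [hent]
    exact meromorphicAt_clm_comp _ (hM z hz)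
  have hunit : ∀ T, IsUnit T ↔ (e T).det ≠ 0 := fun T => by
    rw [← isUnit_iff_ne_zero, ← Matrix.isUnit_iff_isUnit_det, MulEquiv.isUnit_map]
  -- Valid for every `T`: at a non-invertible `T` both the ring inverse and the matrix inverse take
  -- the default value `0`.
  have hinv : ∀ T, Ring.inverse T = ∑ i, ∑ j, (e T)⁻¹ i j • e.symm (Matrix.single i j 1) := by
    intro T
    have h1 : Ring.inverse T = e.symm ((e T)⁻¹) := by
      by_cases hT : IsUnit T
      · obtain ⟨u, rfl⟩ := hT
        have : e (u : E →L[ℂ] E) = (Units.map e.toMonoidHom u : (Matrix _ _ ℂ)ˣ) := rfl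
        rw [Ring.inverse_unit, Matrix.nonsing_inv_eq_ringInverse, this, Ring.inverse_unit,
          ← map_inv]
        exact (e.symm_apply_apply _).symm
      · rw [Ring.inverse_non_unit _ hT, Matrix.nonsing_inv_apply_not_isUnit, map_zero]
        rwa [isUnit_iff_ne_zero, ← hunit]
    rw [h1]
    conv_lhs => rw [Matrix.matrix_eq_sum_single ((e T)⁻¹)]
    simp only [map_sum, ← hsmul]
    refine Finset.sum_congr rfl fun i _ => Finset.sum_congr rfl fun j _ => ?_
    simp
  refine ⟨fun z hz => ?_, fun z hz => ?_⟩
  · simp only [hinv]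
    exact MeromorphicAt.fun_sum fun i _ => MeromorphicAt.fun_sum fun j _ =>
      (meromorphicAt_matrix_inv (hmer z hz) i j).smul (MeromorphicAt.const _ _)
  · have hdet : MeromorphicOn (fun z => (e (M z)).det) U := fun z hz =>
      meromorphicAt_matrix_det (hmer z hz)
    -- A meromorphic function may have an arbitrary value at a single point, so `IsUnit (M z₀)`
    -- alone says nothing nearby; continuity spreads it to a neighbourhood, and connectedness then
    -- rules out a determinant vanishing identically near some point of `U`.
    have hcont : ContinuousAt (fun z => (e (M z)).det) z₀ := by
      have : ContinuousAt (fun z => e (M z)) z₀ := continuousAt_pi.2 fun i =>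
        continuousAt_pi.2 fun j => by
          simp only [hent]
          exact (entry i j).continuous.continuousAt.comp hc
      exact (continuous_id.matrix_det).continuousAt.comp this
    have hne : meromorphicOrderAt (fun z => (e (M z)).det) z₀ ≠ ⊤ := by
      rw [meromorphicOrderAt_ne_top_iff_eventually_ne_zero (hdet z₀ hz₀)]
      exact (hcont.eventually_ne ((hunit _).1 hu)).filter_mono nhdsWithin_le_nhds
    have := hdet.meromorphicOrderAt_ne_top_of_isPreconnected hU hz₀ hz hne
    rw [meromorphicOrderAt_ne_top_iff_eventually_ne_zero (hdet z hz)] at this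
    simpa only [hunit] using this

/-- The meromorphic Fredholm theorem, for a family that is the sum of a small analytic family and
of a finite rank one. -/
theorem meromorphicOn_inverse_one_add [CompleteSpace E] {U : Set ℂ}
    (hUo : IsOpen U) (hU : IsPreconnected U) {S : ℂ → E →L[ℂ] E} (hS : AnalyticOnNhd ℂ S U)
    (hS1 : ∀ z ∈ U, ‖S z‖ < 1) {ι : Type*} (s : Finset ι) (c : ι → ℂ → ℂ)
    (hc : ∀ i ∈ s, MeromorphicOn (c i) U) (T : ι → E →L[ℂ] E)
    (hT : ∀ i ∈ s, FiniteDimensional ℂ (T i).range) {z₀ : ℂ} (hz₀ : z₀ ∈ U)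
    (hcz : ∀ i ∈ s, ContinuousAt (c i) z₀)
    (hu : IsUnit (1 + (S z₀ + ∑ i ∈ s, c i z₀ • T i))) :
    MeromorphicOn (fun z => Ring.inverse (1 + (S z + ∑ i ∈ s, c i z • T i))) U ∧
      ∀ z ∈ U, ∀ᶠ w in 𝓝[≠] z, IsUnit (1 + (S w + ∑ i ∈ s, c i w • T i)) := by
  classical
  -- All finite rank terms land in the one finite dimensional space `Y`, so after inverting `1 + S`
  -- the problem lives on `Y`.
  let Y : Submodule ℂ E := ⨆ i : s, (T i).range
  have : ∀ i : s, FiniteDimensional ℂ (T i).range := fun i => hT i i.2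
  have : FiniteDimensional ℂ Y := Submodule.finiteDimensional_iSup _
  have hTY : ∀ i : s, ∀ x, T i x ∈ Y := fun i x =>
    (le_iSup (fun i : s => (T i).range) i) ⟨x, rfl⟩
  let T' : s → E →L[ℂ] Y := fun i => (T i).codRestrict Y (hTY i)
  let g : ℂ → E →L[ℂ] Y := fun z => ∑ i : s, c i z • T' i
  have hg : ∀ z, ∑ i ∈ s, c i z • T i = Y.subtypeL ∘L g z := fun z => by
    rw [← Finset.sum_coe_sort]
    ext x
    simp [g, T']
  let P : ℂ → E →L[ℂ] E := fun z => Ring.inverse (1 + S z)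
  have hunit : ∀ z ∈ U, IsUnit (1 + S z) := fun z hz => by
    have := isUnit_one_sub_of_norm_lt_one (x := -S z) (by simpa using hS1 z hz)
    simpa using this
  have hP : AnalyticOnNhd ℂ P U := fun z hz => by
    have h1 : AnalyticAt ℂ (fun z => 1 + S z) z := analyticAt_const.add (hS z hz)
    exact AnalyticAt.fun_comp (analyticOnNhd_inverse (𝕜 := ℂ) _ (hunit z hz)) h1
  let M : ℂ → Y →L[ℂ] Y := fun z => 1 + g z ∘L (P z ∘L Y.subtypeL)
  have hgm : MeromorphicOn g U := fun z hz => MeromorphicAt.fun_sum fun i _ =>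
    meromorphicAt_smul_const (hc i i.2 z hz) (T' i)
  have hMm : MeromorphicOn M U := fun z hz => (MeromorphicAt.const _ _).add
    (MeromorphicAt.clm_comp (hgm z hz) (MeromorphicAt.clm_comp (hP z hz).meromorphicAt
      (MeromorphicAt.const _ _)))
  have hMc : ContinuousAt M z₀ := by
    have hgc : ContinuousAt g z₀ := tendsto_finsetSum _ fun i _ =>
      (hcz i i.2).tendsto.smul tendsto_const_nhds
    have hPc := (hP z₀ hz₀).continuousAt
    exact continuousAt_const.add (hgc.clm_comp (hPc.clm_comp continuousAt_const))
  -- The second factor is `1` plus a product through `Y`; swapping the order of the product turns it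
  -- into `M z` on `Y`.
  have hfac : ∀ z ∈ U, 1 + (S z + ∑ i ∈ s, c i z • T i)
      = (1 + S z) * (1 + (P z ∘L Y.subtypeL) ∘L g z) := fun z hz => by
    have h1 : (1 + S z) * P z = 1 := Ring.mul_inverse_cancel _ (hunit z hz)
    rw [hg, mul_add, mul_one, add_assoc, ContinuousLinearMap.comp_assoc]
    congr 2
    change _ = ((1 + S z) * P z) ∘L (Y.subtypeL ∘L g z)
    rw [h1]
    rfl
  have hMu : IsUnit (M z₀) := by
    rw [hfac z₀ hz₀] at hu
    have h := (isUnit_one_add_comp_comm (g z₀) (P z₀ ∘L Y.subtypeL) ?_).1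
    · exact h
    · obtain ⟨v, hv⟩ := hunit z₀ hz₀
      rwa [← hv, Units.isUnit_units_mul] at hu
  obtain ⟨h1, h2⟩ := meromorphicOn_inverse_of_finiteDimensional hU hMm hz₀ hMc hMu
  have hev : ∀ z ∈ U, ∀ᶠ w in 𝓝[≠] z, w ∈ U := fun z hz =>
    (hUo.eventually_mem hz).filter_mono nhdsWithin_le_nhds
  refine ⟨fun z hz => ?_, fun z hz => ?_⟩
  swap
  · filter_upwards [h2 z hz, hev z hz] with w hMw hw
    rw [hfac w hw]
    exact (hunit w hw).mul (isUnit_one_add_comp_comm _ _ hMw).1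
  have hm : MeromorphicAt (fun z => (1 - (P z ∘L Y.subtypeL) ∘L Ring.inverse (M z) ∘L g z) ∘L P z) z :=
    MeromorphicAt.clm_comp ((MeromorphicAt.const _ _).sub (MeromorphicAt.clm_comp
      (MeromorphicAt.clm_comp (hP z hz).meromorphicAt (MeromorphicAt.const _ _))
      (MeromorphicAt.clm_comp (h1 z hz) (hgm z hz)))) (hP z hz).meromorphicAt
  refine hm.congr ?_
  filter_upwards [h2 z hz, hev z hz] with w hw hwU
  obtain ⟨k1, k2⟩ := isUnit_one_add_comp_comm (P w ∘L Y.subtypeL) (g w) hw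
  rw [hfac w hwU, Ring.inverse_mul (.inl (hunit w hwU)), k2]
  rfl

end Meromorphic

/-! ### Summability of the exponential weights -/

section Weights

theorem summable_exp_neg_mul_abs {c : ℝ} (hc : 0 < c) :
    Summable fun n : ℤ => Real.exp (-(c * |(n : ℝ)|)) := by
  have h : Summable fun n : ℕ => Real.exp (-(c * n)) := by
    have := Real.summable_exp_nat_mul_iff.2 (neg_lt_zero.2 hc)
    refine this.congr fun n => ?_
    congr 1
    ring
  refine Summable.of_nat_of_neg ?_ ?_ <;> simpa using h

theorem summable_exp_neg_mul_abs_add {c : ℝ} (hc : 0 < c) :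
    Summable fun p : ℤ × ℤ => Real.exp (-(c * (|(p.1 : ℝ)| + |(p.2 : ℝ)|))) := by
  refine ((summable_exp_neg_mul_abs hc).mul_of_nonneg (summable_exp_neg_mul_abs hc)
    (fun _ => (Real.exp_pos _).le) fun _ => (Real.exp_pos _).le).congr fun p => ?_
  rw [← Real.exp_add]
  congr 1
  ring

end Weights

theorem summable_smul_of_norm_le_one {E F : Type*} [NormedAddCommGroup E] [NormedSpace ℂ E]
    [NormedAddCommGroup F] [NormedSpace ℂ F] [CompleteSpace F] {x : ℤ → ℂ}
    (hx : Summable fun n => ‖x n‖) {T : ℤ → E →L[ℂ] F} (hT : ∀ n, ‖T n‖ ≤ 1) :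
    Summable fun n => x n • T n :=
  Summable.of_norm_bounded hx fun n => by
    rw [norm_smul]
    exact mul_le_of_le_one_right (norm_nonneg _) (hT n)

/-! ### Operators given by absolutely summable matrices -/

section MatrixSums

variable {H : Type*} [NormedAddCommGroup H] [InnerProductSpace ℂ H]

variable (H) in
/-- The embedding of `H` as the sequences supported at `n`. -/
def single (n : ℤ) : H →L[ℂ] L2Z H := lp.singleContinuousLinearMap ℂ (fun _ : ℤ => H) 2 n

variable (H) in
/-- Evaluation at `n`. -/
def eval (n : ℤ) : L2Z H →L[ℂ] H := lp.evalCLM ℂ (fun _ : ℤ => H) 2 n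

@[simp] theorem eval_apply (n : ℤ) (φ : L2Z H) : eval H n φ = φ n := rfl

theorem single_apply (n k : ℤ) (u : H) : single H n u k = if k = n then u else 0 := by
  simp [single, lp.singleContinuousLinearMap_apply, Pi.single_apply]

theorem norm_single_le (n : ℤ) : ‖single H n‖ ≤ 1 :=
  ContinuousLinearMap.opNorm_le_bound _ zero_le_one fun u => by
    rw [one_mul]
    exact (lp.norm_single (E := fun _ : ℤ => H) (p := 2) (by simp) n u).le

theorem norm_eval_le (n : ℤ) : ‖eval H n‖ ≤ 1 :=
  ContinuousLinearMap.opNorm_le_bound _ zero_le_one fun φ => by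
    rw [one_mul]
    exact lp.norm_apply_le_norm (by simp) φ n

/-- The operator whose only nonzero matrix entry is `A`, at `(n, m)`. -/
def matUnit (n m : ℤ) (A : H →L[ℂ] H) : L2Z H →L[ℂ] L2Z H := single H n ∘L A ∘L eval H m

theorem matUnit_apply (n m k : ℤ) (A : H →L[ℂ] H) (φ : L2Z H) :
    matUnit n m A φ k = if k = n then A (φ m) else 0 :=
  single_apply n k (A (φ m))

theorem matUnit_smul (n m : ℤ) (c : ℂ) (A : H →L[ℂ] H) :
    matUnit n m (c • A) = c • matUnit n m A := by
  rw [matUnit, ContinuousLinearMap.smul_comp, ContinuousLinearMap.comp_smul]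
  rfl

theorem norm_matUnit_le (n m : ℤ) (A : H →L[ℂ] H) : ‖matUnit n m A‖ ≤ ‖A‖ := by
  calc ‖matUnit n m A‖ ≤ ‖single H n‖ * (‖A‖ * ‖eval H m‖) :=
        (ContinuousLinearMap.opNorm_comp_le _ _).trans (by
          gcongr; exact ContinuousLinearMap.opNorm_comp_le _ _)
    _ ≤ 1 * (‖A‖ * 1) := by gcongr <;> first | exact norm_single_le n | exact norm_eval_le m
    _ = ‖A‖ := by ring

/-- The operator with matrix `a`, for a matrix with summable norms. -/
def matSum (a : ℤ × ℤ → H →L[ℂ] H) : L2Z H →L[ℂ] L2Z H := ∑' p, matUnit p.1 p.2 (a p)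

variable [CompleteSpace H]

theorem summable_matUnit {a : ℤ × ℤ → H →L[ℂ] H} (ha : Summable fun p => ‖a p‖) :
    Summable fun p => matUnit p.1 p.2 (a p) :=
  Summable.of_norm_bounded ha fun p => norm_matUnit_le p.1 p.2 (a p)

theorem hasSum_matSum_apply {a : ℤ × ℤ → H →L[ℂ] H} (ha : Summable fun p => ‖a p‖) (φ : L2Z H)
    (n : ℤ) : HasSum (fun m => a (n, m) (φ m)) (matSum a φ n) := by
  have h := (summable_matUnit ha).hasSum.mapL
    ((eval H n) ∘L (ContinuousLinearMap.apply ℂ (L2Z H) φ))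
  have hinj : Function.Injective fun m : ℤ => (n, m) := fun _ _ h => (Prod.ext_iff.1 h).2
  refine ((hinj.hasSum_iff ?_).2 h).congr_fun fun m => ?_
  · rintro ⟨k, m⟩ hk
    change matUnit k m (a (k, m)) φ n = 0
    rw [matUnit_apply, if_neg]
    rintro rfl
    exact hk ⟨m, rfl⟩
  · change a (n, m) (φ m) = matUnit n m (a (n, m)) φ n
    rw [matUnit_apply, if_pos rfl]

variable (H) in
/-- The functional `φ ↦ ∑ₘ x(m) φ(m)`. -/
def sumFunctional (x : ℤ → ℂ) : L2Z H →L[ℂ] H := ∑' m, x m • eval H m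

variable (H) in
/-- The embedding `u ↦ (x(n) u)ₙ`. -/
def smulEmbedding (x : ℤ → ℂ) : H →L[ℂ] L2Z H := ∑' n, x n • single H n

theorem hasSum_sumFunctional {x : ℤ → ℂ} (hx : Summable fun n => ‖x n‖) (φ : L2Z H) :
    HasSum (fun m => x m • φ m) (sumFunctional H x φ) := by
  have h : Summable fun m => x m • eval H m := summable_smul_of_norm_le_one hx norm_eval_le
  exact h.hasSum.mapL (ContinuousLinearMap.apply ℂ H φ)

theorem smulEmbedding_apply {x : ℤ → ℂ} (hx : Summable fun n => ‖x n‖) (u : H) (n : ℤ) :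
    smulEmbedding H x u n = x n • u := by
  have h : Summable fun m => x m • single H m := summable_smul_of_norm_le_one hx norm_single_le
  have h1 := h.hasSum.mapL (eval H n ∘L ContinuousLinearMap.apply ℂ (L2Z H) u)
  refine h1.unique ?_
  convert hasSum_single n ?_ using 1
  · change _ = x n • single H n u n
    rw [single_apply, if_pos rfl]
  · intro m hm
    change x m • single H m u n = 0
    rw [single_apply, if_neg hm.symm, smul_zero]

end MatrixSums

/-! ### Commutation of tensor factors, and the finite rank mechanism -/

section Commutation

variable {H : Type*} [NormedAddCommGroup H] [InnerProductSpace ℂ H]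

theorem fiberwise_mul_mulOp (Λ : H →L[ℂ] H) {a : ℤ → ℂ} (ha : ∀ n, ‖a n‖ ≤ 1) :
    Commute (fiberwise Λ) (mulOp H a ha) :=
  ContinuousLinearMap.ext fun φ => lp.ext <| funext fun n => Λ.map_smul (a n) (φ n)

variable [CompleteSpace H]

/-- Pairing with a fixed `u` turns both sides into the scalar commutation relation. It is applied to
the weight and to the sign `(-1)^{|n|}`. -/
theorem ampliation_mul_mulOp {Γ : L2Z ℂ →L[ℂ] L2Z ℂ} {a : ℤ → ℂ} (ha : ∀ n, ‖a n‖ ≤ 1)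
    (h : Commute Γ (mulOp ℂ a ha)) : Commute (ampliation (H := H) Γ) (mulOp H a ha) := by
  refine ContinuousLinearMap.ext fun φ => lp.ext <| funext fun n => ext_inner_left ℂ fun u => ?_
  have h1 : coord u (mulOp H a ha φ) = mulOp ℂ a ha (coord u φ) :=
    lp.ext <| funext fun m => by simp
  change ⟪u, ampliation Γ (mulOp H a ha φ) n⟫_ℂ = ⟪u, a n • ampliation Γ φ n⟫_ℂ
  rw [inner_ampliation_apply, h1, inner_smul_right, inner_ampliation_apply]
  exact congrArg (fun T => T (coord u φ) n) h.eq

theorem ampliation_mul_fiberwise (Γ : L2Z ℂ →L[ℂ] L2Z ℂ) (Λ : H →L[ℂ] H) :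
    Commute (ampliation Γ) (fiberwise Λ) := by
  refine ContinuousLinearMap.ext fun φ => lp.ext <| funext fun n => ext_inner_left ℂ fun u => ?_
  have h1 : coord u (fiberwise Λ φ) = coord (ContinuousLinearMap.adjoint Λ u) φ :=
    lp.ext <| funext fun m => by simp [ContinuousLinearMap.adjoint_inner_left]
  change ⟪u, ampliation Γ (fiberwise Λ φ) n⟫_ℂ = ⟪u, Λ (ampliation Γ φ n)⟫_ℂ
  rw [inner_ampliation_apply, h1, ← ContinuousLinearMap.adjoint_inner_left, inner_ampliation_apply]

theorem tensorOp_mul_mulOp {Γ : L2Z ℂ →L[ℂ] L2Z ℂ} {a : ℤ → ℂ} (ha : ∀ n, ‖a n‖ ≤ 1)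
    (h : Commute Γ (mulOp ℂ a ha)) (Λ : H →L[ℂ] H) : Commute (tensorOp Γ Λ) (mulOp H a ha) :=
  (ampliation_mul_mulOp ha h).mul_left (fiberwise_mul_mulOp Λ ha)

/-- Sandwiching an operator of the form `ι ∘ s` between `Γ₂ ⊗ Λ₂` and `Γ₁ ⊗ Λ₁` gives a finite
rank operator if `Λ₂ Λ₁` has finite rank. -/
theorem finiteDimensional_range_sandwich (Γ₁ Γ₂ : L2Z ℂ →L[ℂ] L2Z ℂ) {Λ₁ Λ₂ : H →L[ℂ] H}
    (hΛ : FiniteDimensional ℂ (Λ₂ * Λ₁ : H →L[ℂ] H).range) (i : H →L[ℂ] L2Z H)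
    (s : L2Z H →L[ℂ] H) (hi : ∀ u, fiberwise Λ₂ (i u) = i (Λ₂ u))
    (hs : ∀ φ, s (fiberwise Λ₁ φ) = Λ₁ (s φ)) (W : L2Z H →L[ℂ] L2Z H) :
    FiniteDimensional ℂ (tensorOp Γ₂ Λ₂ * (i ∘L s) * tensorOp Γ₁ Λ₁ * W).range := by
  -- `Λ₁` moves left through `s` and `Λ₂` moves right through `i`, so that they meet as `Λ₂ Λ₁` on
  -- the fibre.
  have h : tensorOp Γ₂ Λ₂ * (i ∘L s) * tensorOp Γ₁ Λ₁ * W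
      = (ampliation Γ₂ ∘L i) ∘L (Λ₂ * Λ₁) ∘L (s ∘L (ampliation Γ₁ * W)) := by
    ext1 φ
    have h1 : tensorOp Γ₁ Λ₁ (W φ) = fiberwise Λ₁ (ampliation Γ₁ (W φ)) :=
      congrArg (fun T => T (W φ)) (ampliation_mul_fiberwise Γ₁ Λ₁).eq
    change ampliation Γ₂ (fiberwise Λ₂ (i (s (tensorOp Γ₁ Λ₁ (W φ))))) = _
    rw [h1, hs, hi]
    rfl
  have hle : (tensorOp Γ₂ Λ₂ * (i ∘L s) * tensorOp Γ₁ Λ₁ * W).range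
      ≤ (Λ₂ * Λ₁ : H →L[ℂ] H).range.map (ampliation Γ₂ ∘L i : H →L[ℂ] L2Z H).toLinearMap := by
    rintro _ ⟨φ, rfl⟩
    rw [h]
    exact ⟨_, ⟨s (ampliation Γ₁ (W φ)), rfl⟩, rfl⟩
  exact Submodule.finiteDimensional_of_le hle

end Commutation

/-! ### Splitting the weights off the perturbation -/

section Decay

variable {H : Type*} [NormedAddCommGroup H] [InnerProductSpace ℂ H]

variable (H) in
/-- The operator `W_{-γ} ⊗ I`. -/
def decayOp {γ : ℝ} (hγ : 0 < γ) : L2Z H →L[ℂ] L2Z H :=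
  mulOp H (weight (-γ)) (norm_weight_neg_le hγ.le)

theorem decayOp_apply {γ : ℝ} (hγ : 0 < γ) (φ : L2Z H) (n : ℤ) :
    decayOp H hγ φ n = weight (-γ) n • φ n := rfl

theorem summable_norm_weight_neg {γ : ℝ} (hγ : 0 < γ) : Summable fun n => ‖weight (-γ) n‖ := by
  refine (summable_exp_neg_mul_abs (half_pos hγ)).congr fun n => ?_
  rw [norm_weight]
  congr 1
  ring

variable [CompleteSpace H]

/-- An operator with exponentially decaying matrix factors through the weight on both sides. -/
theorem exists_eq_decayOp_mul_mul_decayOp {γ : ℝ} (hγ : 0 < γ) {w : ℤ → ℤ → H →L[ℂ] H}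
    {W : L2Z H →L[ℂ] L2Z H} (hW : IsMatrixOperator w W) {C : ℝ}
    (hw : ∀ n m : ℤ, ‖w n m‖ * Real.exp (γ * (|(n : ℝ)| + |(m : ℝ)|)) ≤ C) :
    ∃ W' : L2Z H →L[ℂ] L2Z H, W = decayOp H hγ * W' * decayOp H hγ := by
  -- The weights cost `e^{γ(|n|+|m|)/2}`, half of the assumed decay; the other half keeps the matrix
  -- summable.
  let a : ℤ × ℤ → H →L[ℂ] H := fun p => (weight γ p.1 * weight γ p.2) • w p.1 p.2
  have ha : Summable fun p => ‖a p‖ := by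
    refine Summable.of_nonneg_of_le (fun _ => norm_nonneg _) (fun p => ?_)
      ((summable_exp_neg_mul_abs_add (half_pos hγ)).mul_left C)
    have h1 := mul_le_mul_of_nonneg_right (hw p.1 p.2)
      (Real.exp_pos (-(γ / 2 * (|(p.1 : ℝ)| + |(p.2 : ℝ)|)))).le
    refine le_trans (le_of_eq ?_) h1
    rw [norm_smul, norm_mul, norm_weight, norm_weight, ← Real.exp_add, mul_assoc, ← Real.exp_add,
      mul_comm]
    congr 2
    ring
  refine ⟨matSum a, ContinuousLinearMap.ext fun φ => lp.ext <| funext fun n => ?_⟩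
  refine (hW φ n).unique ?_
  have h := (hasSum_matSum_apply ha (decayOp H hγ φ) n).const_smul (weight (-γ) n)
  refine h.congr_fun fun m => ?_
  change w n m (φ m) = weight (-γ) n • (weight γ n * weight γ m) • w n m (weight (-γ) m • φ m)
  rw [map_smul, smul_smul, smul_smul, ← mul_assoc, weight_neg_mul_weight, one_mul,
    mul_comm, weight_neg_mul_weight, one_smul]

end Decay

/-! ### The free resolvent as a geometric sum of shifts -/

section FreeResolvent

variable {H : Type*} [NormedAddCommGroup H] [InnerProductSpace ℂ H]

theorem shift_mul_shift (j k : ℤ) : (shift j * shift k : L2Z H →L[ℂ] L2Z H) = shift (j + k) :=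
  ContinuousLinearMap.ext fun φ => lp.ext <| funext fun n => by
    change φ (n + j + k) = φ (n + (j + k))
    rw [add_assoc]

theorem shift_zero : (shift 0 : L2Z H →L[ℂ] L2Z H) = 1 :=
  ContinuousLinearMap.ext fun φ => lp.ext <| funext fun n => by
    change φ (n + 0) = φ n
    rw [add_zero]

theorem norm_shift_le (k : ℤ) : ‖(shift k : L2Z H →L[ℂ] L2Z H)‖ ≤ 1 :=
  LinearMap.mkContinuous_norm_le _ zero_le_one _

theorem summable_norm_pow_natAbs {w : ℂ} (hw : ‖w‖ < 1) :
    Summable fun k : ℤ => ‖w ^ k.natAbs‖ := by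
  have h := summable_geometric_of_lt_one (norm_nonneg w) hw
  refine Summable.of_nat_of_neg ?_ ?_ <;> simpa using h

theorem commute_freeOp_shift (z : ℂ) (k : ℤ) :
    Commute (freeOp H - z • 1) (shift k : L2Z H →L[ℂ] L2Z H) := by
  have h : ∀ j, Commute (shift j) (shift k : L2Z H →L[ℂ] L2Z H) := fun j => by
    rw [Commute, SemiconjBy, shift_mul_shift, shift_mul_shift, add_comm]
  have h1 : ∀ c : ℂ, Commute (c • 1) (shift k : L2Z H →L[ℂ] L2Z H) := fun c =>
    (Commute.one_left _).smul_left c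
  exact (((h1 2).sub_left (h 1)).sub_left (h (-1))).sub_left (h1 z)

/-- `w^{|k|}` is, up to a constant, the Green function of the second difference operator: both `w^k`
and `w^{-k}` solve the homogeneous equation, and the kink at `0` produces the delta. -/
theorem pow_natAbs_recurrence {w : ℂ} (hw : w ≠ 0) (k : ℤ) :
    (w + w⁻¹) * w ^ k.natAbs - w ^ (k - 1).natAbs - w ^ (k + 1).natAbs
      = if k = 0 then w⁻¹ - w else 0 := by
  rcases lt_trichotomy k 0 with h | rfl | h
  · obtain ⟨j, rfl⟩ : ∃ j : ℕ, k = -(j + 1 : ℕ) := ⟨k.natAbs - 1, by omega⟩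
    rw [if_neg h.ne, show (-((j + 1 : ℕ) : ℤ)).natAbs = j + 1 by omega,
      show (-((j + 1 : ℕ) : ℤ) - 1).natAbs = j + 2 by omega,
      show (-((j + 1 : ℕ) : ℤ) + 1).natAbs = j by omega]
    field_simp
    ring
  · simp
  · obtain ⟨j, rfl⟩ : ∃ j : ℕ, k = (j + 1 : ℕ) := ⟨k.natAbs - 1, by omega⟩
    rw [if_neg h.ne', show (((j + 1 : ℕ) : ℤ)).natAbs = j + 1 by omega,
      show (((j + 1 : ℕ) : ℤ) - 1).natAbs = j by omega,
      show (((j + 1 : ℕ) : ℤ) + 1).natAbs = j + 2 by omega]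
    field_simp
    ring

variable [CompleteSpace H]

variable (H) in
/-- `∑ₖ w^{|k|} Sᵏ`, where `S` is the shift. -/
def geometricSum (w : ℂ) : L2Z H →L[ℂ] L2Z H := ∑' k : ℤ, w ^ k.natAbs • shift k

theorem hasSum_geometricSum {w : ℂ} (hw : ‖w‖ < 1) :
    HasSum (fun k : ℤ => w ^ k.natAbs • (shift k : L2Z H →L[ℂ] L2Z H)) (geometricSum H w) :=
  (summable_smul_of_norm_le_one (summable_norm_pow_natAbs hw) norm_shift_le).hasSum

theorem sub_mul_geometric_series {A : Type*} [NormedRing A] [NormedAlgebra ℂ A] {S : ℤ → A}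
    (hS0 : S 0 = 1) (hS : ∀ j k, S j * S k = S (j + k)) {w : ℂ} (hw : w ≠ 0) {g : A}
    (h : HasSum (fun k : ℤ => w ^ k.natAbs • S k) g) :
    (w + w⁻¹) • g - S 1 * g - S (-1) * g = (w⁻¹ - w) • 1 := by
  -- Multiplication by `S j` translates the coefficients, so the identity reduces to the scalar
  -- recurrence, coefficient by coefficient.
  have hs : ∀ j : ℤ, HasSum (fun k : ℤ => w ^ (k - j).natAbs • S k) (S j * g) := fun j => by
    rw [← (Equiv.addRight j).hasSum_iff]
    refine (h.mul_left (S j)).congr_fun fun k => ?_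
    change w ^ (k + j - j).natAbs • S (k + j) = _
    rw [mul_smul_comm, hS, add_sub_cancel_right, add_comm]
  refine (((h.const_smul (w + w⁻¹)).sub (hs 1)).sub (hs (-1))).unique ?_
  have h4 : ∀ k : ℤ, (w + w⁻¹) • w ^ k.natAbs • S k
      - w ^ (k - 1).natAbs • S k - w ^ (k - -1).natAbs • S k
      = (if k = 0 then w⁻¹ - w else 0) • S k := fun k => by
    rw [← pow_natAbs_recurrence hw, sub_neg_eq_add]
    module
  simp only [h4]
  convert hasSum_single (0 : ℤ) ?_ using 1
  · rw [if_pos rfl, hS0]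
  · intro k hk
    rw [if_neg hk, zero_smul]

theorem freeOp_sub_mul_geometricSum {w : ℂ} (hw : w ≠ 0) (hw1 : ‖w‖ < 1) :
    (freeOp H - (2 - w - w⁻¹) • 1) * geometricSum H w = (w⁻¹ - w) • 1 := by
  rw [← sub_mul_geometric_series (S := fun k => (shift k : L2Z H →L[ℂ] L2Z H)) shift_zero
    shift_mul_shift hw (hasSum_geometricSum hw1), freeOp]
  simp only [sub_mul, smul_mul_assoc, one_mul]
  generalize shift 1 * geometricSum H w = x, shift (-1) * geometricSum H w = y,
    geometricSum H w = g
  module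

/-- For `0 < |w| < 1` the point `z = 2 - w - w⁻¹` is in the resolvent set of the free operator, and
the resolvent is a multiple of `∑ₖ w^{|k|} Sᵏ`. -/
theorem freeOp_resolvent {w : ℂ} (hw : w ≠ 0) (hw1 : ‖w‖ < 1) :
    IsUnit (freeOp H - (2 - w - w⁻¹) • 1) ∧
      Ring.inverse (freeOp H - (2 - w - w⁻¹) • 1) = (w⁻¹ - w)⁻¹ • geometricSum H w := by
  have hc : w⁻¹ - w ≠ 0 := fun h => by
    have h1 : w * w = 1 := by
      rw [sub_eq_zero] at h
      nth_rewrite 2 [← h]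
      exact mul_inv_cancel₀ hw
    have h2 := congrArg norm h1
    rw [norm_mul, norm_one] at h2
    nlinarith [norm_nonneg w]
  have h := freeOp_sub_mul_geometricSum (H := H) hw hw1
  have hcomm : Commute (freeOp H - (2 - w - w⁻¹) • 1) (geometricSum H w) :=
    Commute.tsum_right _ fun k => (commute_freeOp_shift _ k).smul_right _
  have m1 : (freeOp H - (2 - w - w⁻¹) • 1) * ((w⁻¹ - w)⁻¹ • geometricSum H w) = 1 := by
    rw [mul_smul_comm, h, smul_smul, inv_mul_cancel₀ hc, one_smul]
  have m2 : ((w⁻¹ - w)⁻¹ • geometricSum H w) * (freeOp H - (2 - w - w⁻¹) • 1) = 1 := by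
    rw [smul_mul_assoc, ← hcomm.eq, h, smul_smul, inv_mul_cancel₀ hc, one_smul]
  let u : (L2Z H →L[ℂ] L2Z H)ˣ := ⟨_, _, m1, m2⟩
  exact ⟨u.isUnit, Ring.inverse_unit u⟩

theorem hasSum_geometricSum_apply {w : ℂ} (hw : ‖w‖ < 1) (φ : L2Z H) (n : ℤ) :
    HasSum (fun m => w ^ (n - m).natAbs • φ m) (geometricSum H w φ n) := by
  have h := (hasSum_geometricSum (H := H) hw).mapL
    (eval H n ∘L ContinuousLinearMap.apply ℂ (L2Z H) φ)
  rw [← (Equiv.addLeft n).hasSum_iff]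
  refine h.congr_fun fun k => ?_
  change w ^ (n - (n + k)).natAbs • φ (n + k) = w ^ k.natAbs • φ (n + k)
  rw [show (n - (n + k)).natAbs = k.natAbs by omega]

end FreeResolvent

/-! ### Continuation of the weighted free resolvent across `w = 1` -/

section WeightedFreeResolvent

/-- The matrix entries of the regular part, at `w = 1`, of the weighted free resolvent. -/
def regCoeff (γ : ℝ) (w : ℂ) (p : ℤ × ℤ) : ℂ :=
  weight (-γ) p.1 * weight (-γ) p.2 *
    ((1 - 2 * ∑ j ∈ Finset.range ((p.1 - p.2).natAbs + 1), w ^ j) / (2 * (1 + w)))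

/-- Removes the pole at `w = 1`: the polar part of `w^{d+1} / (1 - w²)` there is `1 / (2(1 - w))`,
independent of `d = |n - m|`. Writing the remainder with a finite geometric sum leaves only the
denominator `2(1 + w)`. -/
theorem regCoeff_add (γ : ℝ) {w : ℂ} (hw : w ≠ 1) (hw' : 1 + w ≠ 0) (p : ℤ × ℤ) :
    (1 - w)⁻¹ * (weight (-γ) p.1 / 2 * weight (-γ) p.2) + regCoeff γ w p
      = weight (-γ) p.1 * weight (-γ) p.2 * (w ^ ((p.1 - p.2).natAbs + 1) / (1 - w ^ 2)) := by
  have h1 : 1 - w ≠ 0 := sub_ne_zero.2 hw.symm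
  have h2 : 1 - w ^ 2 ≠ 0 := by
    rw [show 1 - w ^ 2 = (1 - w) * (1 + w) by ring]
    exact mul_ne_zero h1 hw'
  rw [regCoeff, show ∑ j ∈ Finset.range ((p.1 - p.2).natAbs + 1), w ^ j
    = (1 - w ^ ((p.1 - p.2).natAbs + 1)) / (1 - w) by
      rw [eq_div_iff h1]; exact geom_sum_mul_neg w _]
  generalize w ^ ((p.1 - p.2).natAbs + 1) = x
  rw [show 1 - w ^ 2 = (1 - w) * (1 + w) by ring]
  field_simp
  ring

/-- The disk in the variable `w` on which we work; it contains `0` and `1`. -/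
def disk (γ : ℝ) : Set ℂ := Metric.ball (1 / 2) (1 / 2 + min (γ / 8) (1 / 4))

theorem norm_lt_of_mem_disk {γ : ℝ} {w : ℂ} (hw : w ∈ disk γ) : ‖w‖ < 1 + min (γ / 8) (1 / 4) := by
  have h := mem_ball_iff_norm.1 hw
  have := norm_le_norm_sub_add w (1 / 2)
  have h2 : ‖(1 / 2 : ℂ)‖ = 1 / 2 := by norm_num
  linarith

/-- The cap `1 / 4` on the extra radius keeps the disk away from `w = -1`, which corresponds to the
other threshold `z = 4`. -/
theorem norm_one_add_ge_of_mem_disk {γ : ℝ} {w : ℂ} (hw : w ∈ disk γ) : 3 / 4 ≤ ‖1 + w‖ := by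
  have h := mem_ball_iff_norm.1 hw
  have h1 : ‖(3 / 2 : ℂ)‖ ≤ ‖1 + w‖ + ‖w - 1 / 2‖ := by
    have := norm_sub_le (1 + w) (w - 1 / 2)
    rwa [show 1 + w - (w - 1 / 2) = 3 / 2 by ring] at this
  have h2 : ‖(3 / 2 : ℂ)‖ = 3 / 2 := by norm_num
  have := min_le_right (γ / 8) (1 / 4)
  linarith

/-- A uniform bound for the matrix entries of the regular part. -/
def regBound (γ : ℝ) (p : ℤ × ℤ) : ℝ :=
  2 * (8 / γ + 1) * Real.exp (-(γ / 4 * (|(p.1 : ℝ)| + |(p.2 : ℝ)|)))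

theorem summable_regBound {γ : ℝ} (hγ : 0 < γ) : Summable (regBound γ) :=
  (summable_exp_neg_mul_abs_add (by positivity)).mul_left _

/-- With `s = |n| + |m|`, the weights give `e^{-γs/2}`, the powers of `w` cost `e^{γs/8}`, and the
number of terms of the geometric sum costs another `e^{γs/8}` up to a constant. A decay `e^{-γs/4}`,
uniform in `w`, remains. -/
theorem norm_regCoeff_le {γ : ℝ} (hγ : 0 < γ) {w : ℂ} (hw : w ∈ disk γ) (p : ℤ × ℤ) :
    ‖regCoeff γ w p‖ ≤ regBound γ p := by
  obtain ⟨n, m⟩ := p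
  set s : ℝ := |(n : ℝ)| + |(m : ℝ)| with hs
  have hs0 : 0 ≤ s := by positivity
  set d := (n - m).natAbs with hd
  have hds : (d : ℝ) ≤ s := by
    rw [hd, Nat.cast_natAbs, Int.cast_abs, Int.cast_sub]
    exact abs_sub _ _
  have hb : ‖w‖ ≤ Real.exp (γ / 8) := by
    have h1 := norm_lt_of_mem_disk hw
    have h2 := min_le_left (γ / 8) (1 / 4)
    have h3 := Real.add_one_le_exp (γ / 8)
    linarith
  have hE : 1 ≤ Real.exp (γ / 8 * s) := Real.one_le_exp (by positivity)
  have hpow : ∀ j ∈ Finset.range (d + 1), ‖w ^ j‖ ≤ Real.exp (γ / 8 * s) := fun j hj => by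
    have hj' : (j : ℝ) ≤ s := le_trans (by exact_mod_cast Finset.mem_range_succ_iff.1 hj) hds
    rw [norm_pow]
    calc ‖w‖ ^ j ≤ Real.exp (γ / 8) ^ j := by gcongr
      _ = Real.exp (γ / 8 * j) := by rw [← Real.exp_nat_mul, mul_comm]
      _ ≤ Real.exp (γ / 8 * s) := by gcongr
  have hsum : ‖∑ j ∈ Finset.range (d + 1), w ^ j‖ ≤ (s + 1) * Real.exp (γ / 8 * s) := by
    refine (norm_sum_le_of_le _ hpow).trans ?_
    rw [Finset.sum_const, Finset.card_range, nsmul_eq_mul]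
    push_cast
    gcongr
  -- The linear growth is traded for an exponential with the same rate as the powers of `w`.
  have hs1 : s + 1 ≤ (8 / γ + 1) * Real.exp (γ / 8 * s) := by
    have h1 := Real.add_one_le_exp (γ / 8 * s)
    have h2 : s = 8 / γ * (γ / 8 * s) := by field_simp
    have h3 : 8 / γ * (γ / 8 * s) ≤ 8 / γ * Real.exp (γ / 8 * s) := by gcongr; linarith
    linarith
  have hnum : ‖1 - 2 * ∑ j ∈ Finset.range (d + 1), w ^ j‖
      ≤ 3 * ((8 / γ + 1) * Real.exp (γ / 8 * s) * Real.exp (γ / 8 * s)) := by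
    have h1 := norm_sub_le (1 : ℂ) (2 * ∑ j ∈ Finset.range (d + 1), w ^ j)
    rw [norm_one, norm_mul, Complex.norm_ofNat] at h1
    have h2 : (s + 1) * Real.exp (γ / 8 * s)
        ≤ (8 / γ + 1) * Real.exp (γ / 8 * s) * Real.exp (γ / 8 * s) := by gcongr
    have h3 : 1 ≤ (s + 1) * Real.exp (γ / 8 * s) := by nlinarith
    linarith
  have hden : 3 / 2 ≤ ‖2 * (1 + w)‖ := by
    rw [norm_mul, Complex.norm_ofNat]
    linarith [norm_one_add_ge_of_mem_disk hw]
  have hfrac : ‖(1 - 2 * ∑ j ∈ Finset.range (d + 1), w ^ j) / (2 * (1 + w))‖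
      ≤ 2 * ((8 / γ + 1) * Real.exp (γ / 8 * s) * Real.exp (γ / 8 * s)) := by
    rw [norm_div, div_le_iff₀ (by linarith)]
    refine hnum.trans ?_
    have : 0 ≤ (8 / γ + 1) * Real.exp (γ / 8 * s) * Real.exp (γ / 8 * s) := by positivity
    nlinarith
  have hwt : ‖weight (-γ) n * weight (-γ) m‖ = Real.exp (-(γ / 2 * s)) := by
    rw [norm_mul, norm_weight, norm_weight, ← Real.exp_add, hs]
    congr 1
    ring
  rw [regCoeff, norm_mul, hwt, regBound]
  refine (mul_le_mul_of_nonneg_left hfrac (Real.exp_pos _).le).trans (le_of_eq ?_)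
  have : Real.exp (-(γ / 4 * s))
      = Real.exp (-(γ / 2 * s)) * Real.exp (γ / 8 * s) * Real.exp (γ / 8 * s) := by
    rw [← Real.exp_add, ← Real.exp_add]
    congr 1
    ring
  change _ = 2 * (8 / γ + 1) * Real.exp (-(γ / 4 * s))
  rw [this]
  ring

theorem differentiableOn_regCoeff (γ : ℝ) (p : ℤ × ℤ) :
    DifferentiableOn ℂ (fun w => regCoeff γ w p) (disk γ) := by
  intro w hw
  have h : 2 * (1 + w) ≠ 0 := by
    refine mul_ne_zero two_ne_zero fun h => ?_
    have := norm_one_add_ge_of_mem_disk hw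
    rw [h, norm_zero] at this
    norm_num at this
  refine DifferentiableAt.differentiableWithinAt ?_
  unfold regCoeff
  have h1 : DifferentiableAt ℂ (fun w : ℂ => 2 * (1 + w)) w := by fun_prop
  have h2 : DifferentiableAt ℂ
      (fun w : ℂ => 1 - 2 * ∑ j ∈ Finset.range ((p.1 - p.2).natAbs + 1), w ^ j) w := by fun_prop
  exact (h2.fun_div h1 h).const_mul _

variable {H : Type*} [NormedAddCommGroup H] [InnerProductSpace ℂ H]

variable (H) in
/-- The residue at `w = 1` of the weighted free resolvent, up to sign. -/
def freeResidue (γ : ℝ) : L2Z H →L[ℂ] L2Z H :=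
  smulEmbedding H (fun n => weight (-γ) n / 2) ∘L sumFunctional H (weight (-γ))

variable (H) in
/-- The weighted free resolvent `W_{-γ} (H₀ - z)⁻¹ W_{-γ}`, `z = 2 - w - w⁻¹`, continued to the
disk. -/
def weightedFreeResolvent (γ : ℝ) (w : ℂ) : L2Z H →L[ℂ] L2Z H :=
  (1 - w)⁻¹ • freeResidue H γ + matSum fun p => regCoeff γ w p • 1

variable [CompleteSpace H]

theorem summable_norm_regCoeff {γ : ℝ} (hγ : 0 < γ) {w : ℂ} (hw : w ∈ disk γ) :
    Summable fun p => ‖regCoeff γ w p • (1 : H →L[ℂ] H)‖ :=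
  Summable.of_nonneg_of_le (fun _ => norm_nonneg _) (fun p => by
    rw [norm_smul]
    exact (mul_le_of_le_one_right (norm_nonneg _) ContinuousLinearMap.norm_id_le).trans
      (norm_regCoeff_le hγ hw p)) (summable_regBound hγ)

theorem hasSum_weightedFreeResolvent_apply {γ : ℝ} (hγ : 0 < γ) {w : ℂ} (hw : w ∈ disk γ)
    (hw1 : w ≠ 1) (φ : L2Z H) (n : ℤ) :
    HasSum (fun m => (weight (-γ) n * weight (-γ) m * (w ^ ((n - m).natAbs + 1) / (1 - w ^ 2)))
      • φ m) (weightedFreeResolvent H γ w φ n) := by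
  have h1 := ((hasSum_sumFunctional (summable_norm_weight_neg hγ) φ).const_smul
    (weight (-γ) n / 2)).const_smul (1 - w)⁻¹
  have h2 := hasSum_matSum_apply (summable_norm_regCoeff (H := H) hγ hw) φ n
  have h3 : Summable fun n => ‖weight (-γ) n / 2‖ := by
    simpa [norm_div] using (summable_norm_weight_neg hγ).div_const 2
  have h4 : weightedFreeResolvent H γ w φ n = (1 - w)⁻¹ • (weight (-γ) n / 2) •
      sumFunctional H (weight (-γ)) φ + matSum (fun p => regCoeff γ w p • 1) φ n := by
    rw [← smulEmbedding_apply h3]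
    rfl
  rw [h4]
  refine (h1.add h2).congr_fun fun m => ?_
  have h5 : 1 + w ≠ 0 := fun h => by
    have := norm_one_add_ge_of_mem_disk hw
    rw [h, norm_zero] at this
    norm_num at this
  rw [← regCoeff_add γ hw1 h5 (n, m)]
  simp only [_root_.smul_apply, one_apply_eq_self, smul_smul, ← add_smul]

/-- The exponent `|n - m| + 1` is positive, so every entry vanishes at `w = 0`, which is `z = ∞`.
This supplies the base point of the Fredholm argument with no smallness condition on `V`. -/
theorem weightedFreeResolvent_zero {γ : ℝ} (hγ : 0 < γ) (h0 : 0 ∈ disk γ) :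
    weightedFreeResolvent H γ 0 = 0 := by
  refine ContinuousLinearMap.ext fun φ => lp.ext <| funext fun n => ?_
  refine (hasSum_weightedFreeResolvent_apply hγ h0 zero_ne_one φ n).unique ?_
  simp

theorem weightedFreeResolvent_eq {γ : ℝ} (hγ : 0 < γ) {w : ℂ} (hw : w ∈ disk γ) (hw0 : w ≠ 0)
    (hw1 : ‖w‖ < 1) :
    decayOp H hγ * Ring.inverse (freeOp H - (2 - w - w⁻¹) • 1) * decayOp H hγ
      = weightedFreeResolvent H γ w := by
  have hne : w ≠ 1 := by
    rintro rfl
    simp at hw1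
  refine ContinuousLinearMap.ext fun φ => lp.ext <| funext fun n => ?_
  refine HasSum.unique ?_ (hasSum_weightedFreeResolvent_apply hγ hw hne φ n)
  rw [(freeOp_resolvent hw0 hw1).2]
  have h := ((hasSum_geometricSum_apply hw1 (decayOp H hγ φ) n).const_smul (w⁻¹ - w)⁻¹).const_smul
    (weight (-γ) n)
  refine h.congr_fun fun m => ?_
  rw [decayOp_apply, smul_smul, smul_smul, smul_smul]
  congr 1
  have h1 : w ^ ((n - m).natAbs + 1) / (1 - w ^ 2) = (w⁻¹ - w)⁻¹ * w ^ (n - m).natAbs := by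
    rw [show w⁻¹ - w = (1 - w ^ 2) / w by field_simp, inv_div, pow_succ]
    ring
  rw [h1]
  ring

end WeightedFreeResolvent

/-! ### Meromorphic inversion of `1 + K(w)` -/

section Fredholm

variable {H : Type*} [NormedAddCommGroup H] [InnerProductSpace ℂ H]

theorem fiberwise_single (Λ : H →L[ℂ] H) (n : ℤ) (u : H) :
    fiberwise Λ (single H n u) = single H n (Λ u) :=
  lp.ext <| funext fun k => by
    rw [fiberwise_apply, single_apply, single_apply]
    split_ifs <;> simp

variable [CompleteSpace H]

theorem isOpen_disk (γ : ℝ) : IsOpen (disk γ) := Metric.isOpen_ball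

theorem isPreconnected_disk (γ : ℝ) : IsPreconnected (disk γ) :=
  (convex_ball _ _).isPreconnected

theorem zero_mem_disk {γ : ℝ} (hγ : 0 < γ) : (0 : ℂ) ∈ disk γ := by
  rw [disk, mem_ball_iff_norm]
  have : 0 < min (γ / 8) (1 / 4) := by positivity
  norm_num
  simpa using this

theorem one_mem_disk {γ : ℝ} (hγ : 0 < γ) : (1 : ℂ) ∈ disk γ := by
  rw [disk, mem_ball_iff_norm]
  have : 0 < min (γ / 8) (1 / 4) := by positivity
  norm_num
  simpa using this

theorem norm_matUnit_regCoeff_le {γ : ℝ} (hγ : 0 < γ) {w : ℂ} (hw : w ∈ disk γ) (p : ℤ × ℤ) :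
    ‖matUnit p.1 p.2 (regCoeff γ w p • (1 : H →L[ℂ] H))‖ ≤ regBound γ p := by
  refine (norm_matUnit_le _ _ _).trans ?_
  rw [norm_smul]
  exact (mul_le_of_le_one_right (norm_nonneg _) ContinuousLinearMap.norm_id_le).trans
    (norm_regCoeff_le hγ hw p)

theorem differentiableOn_matUnit_regCoeff (γ : ℝ) (p : ℤ × ℤ) :
    DifferentiableOn ℂ (fun w => matUnit p.1 p.2 (regCoeff γ w p • (1 : H →L[ℂ] H))) (disk γ) := by
  simp only [matUnit_smul]
  exact (differentiableOn_regCoeff γ p).smul_const _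

theorem differentiableOn_matSum_regCoeff {γ : ℝ} (hγ : 0 < γ) :
    DifferentiableOn ℂ (fun w => matSum fun p => regCoeff γ w p • (1 : H →L[ℂ] H)) (disk γ) :=
  Complex.differentiableOn_tsum_of_summable_norm (summable_regBound hγ)
    (differentiableOn_matUnit_regCoeff γ) (isOpen_disk γ)
    fun p _ hw => norm_matUnit_regCoeff_le hγ hw p

theorem meromorphicAt_inv_one_sub (z : ℂ) : MeromorphicAt (fun w : ℂ => (1 - w)⁻¹) z :=
  ((MeromorphicAt.const 1 z).sub (MeromorphicAt.id z)).inv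

theorem meromorphicOn_weightedFreeResolvent {γ : ℝ} (hγ : 0 < γ) :
    MeromorphicOn (weightedFreeResolvent H γ) (disk γ) := fun z hz =>
  (meromorphicAt_smul_const (meromorphicAt_inv_one_sub z) _).add
    ((differentiableOn_matSum_regCoeff hγ).analyticOnNhd (isOpen_disk γ) z hz).meromorphicAt

/-- The matrix sum is approximated by its partial sums, uniformly on the disk. -/
theorem exists_finset_norm_matSum_sub_lt {γ : ℝ} (hγ : 0 < γ) {ε : ℝ} (hε : 0 < ε) :
    ∃ s : Finset (ℤ × ℤ), ∀ w ∈ disk γ,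
      ‖(matSum fun p => regCoeff γ w p • (1 : H →L[ℂ] H))
        - ∑ p ∈ s, regCoeff γ w p • matUnit p.1 p.2 1‖ < ε := by
  have h := tendstoUniformlyOn_tsum (summable_regBound hγ) (s := disk γ)
    (f := fun p w => matUnit p.1 p.2 (regCoeff γ w p • (1 : H →L[ℂ] H)))
    fun p _ hw => norm_matUnit_regCoeff_le hγ hw p
  obtain ⟨s, hs⟩ := (Metric.tendstoUniformlyOn_iff.1 h ε hε).exists
  refine ⟨s, fun w hw => ?_⟩
  have := hs w hw
  rw [dist_eq_norm] at this
  simpa only [matUnit_smul, matSum] using this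

theorem fiberwise_smulEmbedding {x : ℤ → ℂ} (hx : Summable fun n => ‖x n‖) (Λ : H →L[ℂ] H) (u : H) :
    fiberwise Λ (smulEmbedding H x u) = smulEmbedding H x (Λ u) :=
  lp.ext <| funext fun n => by
    rw [fiberwise_apply, smulEmbedding_apply hx, smulEmbedding_apply hx, map_smul]

theorem sumFunctional_fiberwise {x : ℤ → ℂ} (hx : Summable fun n => ‖x n‖) (Λ : H →L[ℂ] H)
    (φ : L2Z H) : sumFunctional H x (fiberwise Λ φ) = Λ (sumFunctional H x φ) := by
  refine (hasSum_sumFunctional hx (fiberwise Λ φ)).unique ?_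
  refine ((hasSum_sumFunctional hx φ).mapL Λ).congr_fun fun m => ?_
  rw [map_smul, fiberwise_apply]

/-- The Birman–Schwinger type operator attached to `V = (Γ₁ ⊗ Λ₁) W (Γ₂ ⊗ Λ₂)`. -/
def birmanSchwinger (γ : ℝ) (A B W : L2Z H →L[ℂ] L2Z H) (w : ℂ) : L2Z H →L[ℂ] L2Z H :=
  B * weightedFreeResolvent H γ w * A * W

theorem meromorphicOn_inverse_one_add_birmanSchwinger {γ : ℝ} (hγ : 0 < γ)
    (Γ₁ Γ₂ : L2Z ℂ →L[ℂ] L2Z ℂ) {Λ₁ Λ₂ : H →L[ℂ] H}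
    (hΛ : FiniteDimensional ℂ (Λ₂ * Λ₁ : H →L[ℂ] H).range) (W : L2Z H →L[ℂ] L2Z H) :
    MeromorphicOn (fun w => Ring.inverse
        (1 + birmanSchwinger γ (tensorOp Γ₁ Λ₁) (tensorOp Γ₂ Λ₂) W w)) (disk γ) ∧
      ∀ z ∈ disk γ, ∀ᶠ w in 𝓝[≠] z,
        IsUnit (1 + birmanSchwinger γ (tensorOp Γ₁ Λ₁) (tensorOp Γ₂ Λ₂) W w) := by
  set A := tensorOp Γ₁ Λ₁
  set B := tensorOp Γ₂ Λ₂
  let Φ : (L2Z H →L[ℂ] L2Z H) →L[ℂ] (L2Z H →L[ℂ] L2Z H) :=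
    ContinuousLinearMap.mul ℂ (L2Z H →L[ℂ] L2Z H) B ∘L
      (ContinuousLinearMap.mul ℂ (L2Z H →L[ℂ] L2Z H)).flip (A * W)
  have hΦ : ∀ T, Φ T = B * T * A * W := fun T => by
    change B * (T * (A * W)) = _
    simp only [mul_assoc]
  -- This tolerance makes the tail, after sandwiching by `Φ`, of norm below `1`; the `+ 1` covers `Φ
  -- = 0`.
  obtain ⟨s, hs⟩ := exists_finset_norm_matSum_sub_lt (H := H) hγ (ε := (‖Φ‖ + 1)⁻¹) (by positivity)
  let S₀ : ℂ → L2Z H →L[ℂ] L2Z H := fun w => (matSum fun p => regCoeff γ w p • (1 : H →L[ℂ] H))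
    - ∑ p ∈ s, regCoeff γ w p • matUnit p.1 p.2 1
  -- The index `none` carries the pole at `w = 1`, the others the finitely many matrix units kept
  -- out of the small part.
  let c : Option (ℤ × ℤ) → ℂ → ℂ := fun i w => i.elim (1 - w)⁻¹ fun p => regCoeff γ w p
  let T : Option (ℤ × ℤ) → L2Z H →L[ℂ] L2Z H := fun i =>
    Φ (i.elim (freeResidue H γ) fun p => matUnit p.1 p.2 1)
  have hK : ∀ w, birmanSchwinger γ A B W w
      = Φ (S₀ w) + ∑ i ∈ Finset.insertNone s, c i w • T i := fun w => by
    rw [Finset.sum_insertNone, birmanSchwinger, ← hΦ, weightedFreeResolvent, map_sub, map_sum,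
      map_add, map_smul]
    simp only [map_smul]
    change _ = _ + ((1 - w)⁻¹ • Φ (freeResidue H γ)
      + ∑ p ∈ s, regCoeff γ w p • Φ (matUnit p.1 p.2 1))
    abel
  have hS₀ : AnalyticOnNhd ℂ S₀ (disk γ) := by
    refine DifferentiableOn.analyticOnNhd ?_ (isOpen_disk γ)
    exact (differentiableOn_matSum_regCoeff hγ).sub (DifferentiableOn.fun_sum fun p _ =>
      (differentiableOn_regCoeff γ p).smul_const _)
  have hwt : Summable fun n => ‖weight (-γ) n / 2‖ := by
    simpa [norm_div] using (summable_norm_weight_neg hγ).div_const 2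
  have hT : ∀ i ∈ Finset.insertNone s, FiniteDimensional ℂ (T i).range := by
    rintro (_ | p) -
    · change FiniteDimensional ℂ (Φ (freeResidue H γ)).range
      rw [hΦ]
      exact finiteDimensional_range_sandwich Γ₁ Γ₂ hΛ _ _ (fiberwise_smulEmbedding hwt Λ₂)
        (sumFunctional_fiberwise (summable_norm_weight_neg hγ) Λ₁) W
    · change FiniteDimensional ℂ (Φ (matUnit p.1 p.2 1)).range
      rw [hΦ]
      exact finiteDimensional_range_sandwich Γ₁ Γ₂ hΛ (single H p.1) (eval H p.2)
        (fiberwise_single Λ₂ p.1) (fun _ => rfl) W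
  have hc : ∀ i ∈ Finset.insertNone s, MeromorphicOn (c i) (disk γ) := by
    rintro (_ | p) - z hz
    · exact meromorphicAt_inv_one_sub z
    · exact ((differentiableOn_regCoeff γ p).analyticOnNhd (isOpen_disk γ) z hz).meromorphicAt
  have h0 := zero_mem_disk hγ
  have hcz : ∀ i ∈ Finset.insertNone s, ContinuousAt (c i) 0 := by
    rintro (_ | p) -
    · exact ContinuousAt.inv₀ (by fun_prop) (by simp)
    · exact ((differentiableOn_regCoeff γ p).differentiableAt
        ((isOpen_disk γ).mem_nhds h0)).continuousAt
  have hS1 : ∀ z ∈ disk γ, ‖Φ (S₀ z)‖ < 1 := fun z hz => by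
    calc ‖Φ (S₀ z)‖ ≤ ‖Φ‖ * ‖S₀ z‖ := Φ.le_opNorm _
      _ ≤ ‖Φ‖ * (‖Φ‖ + 1)⁻¹ := by gcongr; exact (hs z hz).le
      _ < 1 := by
        rw [← div_eq_mul_inv, div_lt_one (by positivity)]
        linarith
  have := meromorphicOn_inverse_one_add (isOpen_disk γ) (isPreconnected_disk γ)
    (S := fun w => Φ (S₀ w)) (fun z hz => (Φ.analyticAt _).comp (hS₀ z hz)) hS1
    (Finset.insertNone s) c hc T hT h0 hcz (by
      rw [← hK, birmanSchwinger, weightedFreeResolvent_zero hγ h0]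
      simp)
  simpa only [hK] using this

end Fredholm

/-! ### The uniformizing variable near the threshold -/

section Uniformizer

/-- `e^{ik/2}`, where `l = 2 sin(k/2)`. -/
def halfPhase (l : ℂ) : ℂ := Complex.I * l / 2 + (1 - l ^ 2 / 4) ^ (1 / 2 : ℂ)

theorem one_sub_sq_mem_slitPlane {l : ℂ} (hl : ‖l‖ < 1) : 1 - l ^ 2 / 4 ∈ Complex.slitPlane := by
  refine Or.inl ?_
  have h1 := (Complex.abs_re_le_norm (l ^ 2 / 4))
  have h2 : ‖l ^ 2 / 4‖ < 1 := by
    rw [norm_div, norm_pow, Complex.norm_ofNat]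
    nlinarith [norm_nonneg l]
  rw [Complex.sub_re, Complex.one_re]
  linarith [le_abs_self (l ^ 2 / 4).re]

/-- With `s² = 1 - l² / 4` this is `(s + il/2)(s - il/2) = s² + l²/4`. Only the square of the root
enters, so no branch condition on `l` is needed. -/
theorem halfPhase_mul (l : ℂ) : halfPhase l * (halfPhase l - Complex.I * l) = 1 := by
  have h : ((1 - l ^ 2 / 4) ^ (1 / 2 : ℂ)) ^ 2 = 1 - l ^ 2 / 4 := by
    rw [one_div]
    exact Complex.cpow_ofNat_inv_pow _ 2
  rw [halfPhase]
  linear_combination h - l ^ 2 / 4 * Complex.I_sq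

theorem halfPhase_ne_zero (l : ℂ) : halfPhase l ≠ 0 :=
  left_ne_zero_of_mul_eq_one (halfPhase_mul l)

theorem halfPhase_sub_inv (l : ℂ) : halfPhase l - (halfPhase l)⁻¹ = Complex.I * l := by
  rw [← eq_inv_of_mul_eq_one_right (halfPhase_mul l)]
  ring

theorem analyticAt_halfPhase {l : ℂ} (hl : ‖l‖ < 1) : AnalyticAt ℂ halfPhase l := by
  unfold halfPhase
  have h : AnalyticAt ℂ (fun l : ℂ => 1 - l ^ 2 / 4) l := by fun_prop
  exact AnalyticAt.add (by fun_prop) (h.cpow analyticAt_const (one_sub_sq_mem_slitPlane hl))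

/-- For `h = halfPhase l`, the real part of `h - h⁻¹ = il` reads `Re h · (1 - |h|⁻²) = -Im l < 0`.
So the upper half of the `l`-disk is the physical sheet `|w| < 1`. -/
theorem norm_halfPhase_lt_one {l : ℂ} (hre : 0 < (halfPhase l).re) (him : 0 < l.im) :
    ‖halfPhase l‖ < 1 := by
  have h := congrArg Complex.re (halfPhase_sub_inv l)
  rw [Complex.sub_re, Complex.inv_re] at h
  have h1 : (Complex.I * l).re = -l.im := by simp
  have hN : 0 < Complex.normSq (halfPhase l) := Complex.normSq_pos.2 (halfPhase_ne_zero l)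
  rw [h1] at h
  have h2 : (halfPhase l).re < (halfPhase l).re / Complex.normSq (halfPhase l) := by linarith
  rw [lt_div_iff₀ hN] at h2
  have h3 : Complex.normSq (halfPhase l) < 1 := by nlinarith
  rw [Complex.normSq_eq_norm_sq] at h3
  nlinarith [norm_nonneg (halfPhase l)]

/-- The uniformizing variable `w = e^{ik}`, for which `l² = 2 - w - w⁻¹`. -/
def phase (l : ℂ) : ℂ := halfPhase l ^ 2

theorem phase_ne_zero (l : ℂ) : phase l ≠ 0 := pow_ne_zero 2 (halfPhase_ne_zero l)

theorem two_sub_phase_sub_inv (l : ℂ) : 2 - phase l - (phase l)⁻¹ = l ^ 2 := by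
  have h := congrArg (· ^ 2) (halfPhase_sub_inv l)
  have h0 := halfPhase_ne_zero l
  simp only [sub_sq, mul_assoc, mul_inv_cancel₀ h0, mul_pow, Complex.I_sq] at h
  rw [phase, ← inv_pow]
  linear_combination -h

theorem phase_ne_one {l : ℂ} (hl : l ≠ 0) : phase l ≠ 1 := fun h => by
  have h1 := two_sub_phase_sub_inv l
  rw [h] at h1
  norm_num at h1
  exact hl (pow_eq_zero_iff two_ne_zero |>.1 h1.symm)

theorem halfPhase_zero : halfPhase 0 = 1 := by simp [halfPhase]

/-- The radius depends on `γ` alone, which is what makes `ε₀` independent of `V`. -/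
theorem exists_radius_phase {γ : ℝ} (hγ : 0 < γ) :
    ∃ ε : ℝ, 0 < ε ∧ ε ≤ γ / 8 ∧ ∀ l ∈ Metric.ball (0 : ℂ) ε,
      AnalyticAt ℂ phase l ∧ phase l ∈ disk γ ∧ (0 < l.im → ‖phase l‖ < 1) := by
  have hc : ContinuousAt halfPhase 0 := (analyticAt_halfPhase (by simp)).continuousAt
  have hc2 : ContinuousAt phase 0 := hc.pow 2
  have h1 : ∀ᶠ l in 𝓝 (0 : ℂ), phase l ∈ disk γ := hc2.eventually_mem <| by
    rw [phase, halfPhase_zero, one_pow]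
    exact (isOpen_disk γ).mem_nhds (one_mem_disk hγ)
  have h2 : ∀ᶠ l in 𝓝 (0 : ℂ), 0 < (halfPhase l).re := by
    have : ContinuousAt (fun l => (halfPhase l).re) 0 := Complex.continuous_re.continuousAt.comp hc
    refine this.eventually (lt_mem_nhds ?_)
    simp [halfPhase_zero]
  obtain ⟨δ, hδ, h⟩ := Metric.eventually_nhds_iff_ball.1 (h1.and h2)
  -- `δ` keeps `phase l` in the disk and `Re (halfPhase l)` positive, `1` keeps the square root off
  -- its cut, and `γ / 8` is the bound required in the theorem.
  refine ⟨min (min δ 1) (γ / 8), by positivity, min_le_right _ _, fun l hl => ?_⟩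
  rw [Metric.mem_ball, lt_min_iff, lt_min_iff] at hl
  have hl1 : ‖l‖ < 1 := by simpa using hl.1.2
  obtain ⟨h3, h4⟩ := h l hl.1.1
  refine ⟨(analyticAt_halfPhase hl1).pow 2, h3, fun him => ?_⟩
  rw [phase, norm_pow]
  exact pow_lt_one₀ (norm_nonneg _) (norm_halfPhase_lt_one h4 him) two_ne_zero

end Uniformizer

/-! ### Exchange of the two thresholds -/

section Conjugation

variable {H : Type*} [NormedAddCommGroup H] [InnerProductSpace ℂ H] [CompleteSpace H]

/-- The assumption on the perturbation is inherited by `-V_J`. -/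
theorem IsAdmissible.neg_conjSign {γ : ℝ} {hγ : 0 < γ} {V : L2Z H →L[ℂ] L2Z H}
    (hV : IsAdmissible γ hγ V) : IsAdmissible γ hγ (-conjSign V) := by
  obtain ⟨Γ₁, Γ₂, Λ₁, Λ₂, w, W, rfl, hW, h1, hJ1, h2, hJ2, hΛ, hfin, C, hC, hw⟩ := hV
  let j : ℤ → ℂ := fun n => (-1) ^ n.natAbs
  have hj : ∀ n, ‖j n‖ = 1 := by simp [j]
  have k1 : Commute (tensorOp Γ₁ Λ₁) (signOp H) := tensorOp_mul_mulOp _ hJ1 Λ₁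
  have k2 : Commute (tensorOp Γ₂ Λ₂) (signOp H) := tensorOp_mul_mulOp _ hJ2 Λ₂
  -- `J` passes through the outer factors, so only the matrix changes, and only by signs, which
  -- preserve its norm bound.
  refine ⟨Γ₁, Γ₂, Λ₁, Λ₂, fun n m => -((j n * j m) • w n m), -(signOp H * W * signOp H), ?_, ?_,
    h1, hJ1, h2, hJ2, hΛ, hfin, C, hC, fun n m => ?_⟩
  · rw [conjSign, mul_neg, neg_mul, neg_inj]
    simp only [mul_assoc]
    rw [k2.eq, ← mul_assoc, ← k1.eq]
    simp only [mul_assoc]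
  · intro φ n
    have h := ((hW (signOp H φ) n).const_smul (j n)).neg
    refine h.congr_fun fun m => ?_
    change -((j n * j m) • w n m (φ m)) = -(j n • w n m (j m • φ m))
    rw [map_smul, smul_smul]
  · rw [norm_neg, norm_smul, norm_mul, hj, hj, one_mul, one_mul]
    exact hw n m

theorem IsAdmissible.perturbation {γ : ℝ} {hγ : 0 < γ} {V : L2Z H →L[ℂ] L2Z H}
    (hV : IsAdmissible γ hγ V) (μ : Threshold) : IsAdmissible γ hγ (μ.perturbation V) := by
  cases μ
  · exact hV
  · exact hV.neg_conjSign

end Conjugation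

/-! ### The perturbed resolvent in terms of `(1 + K(w))⁻¹` -/

section Resolvent

/-- For `ε > 0` it is the image of a half-plane under the exponential. Needed for the identity
theorem. -/
theorem isPreconnected_puncturedDisk (ε : ℝ) : IsPreconnected (puncturedDisk ε) := by
  rcases le_or_gt ε 0 with hε | hε
  · rw [puncturedDisk, Metric.ball_eq_empty.2 hε, Set.empty_sdiff]
    exact isPreconnected_empty
  have h : puncturedDisk ε = Complex.exp '' {z | z.re < Real.log ε} := by
    ext l
    constructor
    · rintro ⟨h1, h2⟩
      have hl : l ≠ 0 := h2
      refine ⟨Complex.log l, ?_, Complex.exp_log hl⟩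
      change (Complex.log l).re < _
      rw [Complex.log_re]
      exact Real.log_lt_log (norm_pos_iff.2 hl) (by simpa using h1)
    · rintro ⟨z, hz, rfl⟩
      refine ⟨?_, Complex.exp_ne_zero z⟩
      rw [mem_ball_zero_iff, Complex.norm_exp]
      exact (Real.lt_log_iff_exp_lt hε).1 hz
  rw [h]
  exact ((convex_halfSpace_re_lt _).isPreconnected).image _ Complex.continuous_exp.continuousOn

variable {H : Type*} [NormedAddCommGroup H] [InnerProductSpace ℂ H]

variable (H) in
/-- The isometry `ℓ²_γ → ℓ²` given by multiplication with the weight. -/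
def weightCLM (γ : ℝ) : WeightedL2Z γ H →L[ℂ] L2Z H :=
  LinearMap.mkContinuous (WeightedL2Z.toL2Z γ H) 1 fun f => by
    rw [one_mul]; exact (WeightedL2Z.norm_toL2Z γ H f).le

theorem weight_smul_weight_smul (s : ℝ) (n : ℤ) (u : H) :
    weight (-s) n • weight s n • u = u := by
  rw [smul_smul, weight_neg_mul_weight, one_smul]

theorem memℓp_weight_smul_weight_smul (γ : ℝ) (φ : L2Z H) :
    Memℓp (fun n => weight (-γ) n • weight γ n • φ n) 2 := by
  simp only [weight_smul_weight_smul]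
  exact φ.2

variable (H) in
/-- The isometry `ℓ² → ℓ²_{-γ}` inverse to multiplication with the weight. -/
def unweightCLM (γ : ℝ) : L2Z H →L[ℂ] WeightedL2Z (-γ) H :=
  LinearMap.mkContinuous
    { toFun := fun φ => ⟨fun n => weight γ n • φ n, memℓp_weight_smul_weight_smul γ φ⟩
      map_add' := fun φ ψ => Subtype.ext <| funext fun n => smul_add (weight γ n) (φ n) (ψ n)
      map_smul' := fun c φ => Subtype.ext <| funext fun n => smul_comm (weight γ n) c (φ n) }
    1 fun φ => by
      rw [one_mul, ← WeightedL2Z.norm_toL2Z]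
      refine le_of_eq (congrArg norm (lp.ext <| funext fun n => ?_))
      exact weight_smul_weight_smul γ n (φ n)

/-- The two inclusions are isometries composed with `decayOp`, so it suffices to continue the
sandwiched resolvent on the unweighted space. -/
theorem weightedResolvent_eq {γ : ℝ} (hγ : 0 < γ) (V : L2Z H →L[ℂ] L2Z H) (z : ℂ) :
    weightedResolvent γ hγ V z = unweightCLM H γ ∘L
      (decayOp H hγ * Ring.inverse (perturbedOp V - z • 1) * decayOp H hγ) ∘L weightCLM H γ := by
  refine ContinuousLinearMap.ext fun f => Subtype.ext <| funext fun n => ?_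
  set ψ := Ring.inverse (perturbedOp V - z • 1) (decayOp H hγ (weightCLM H γ f))
  change ψ n = weight γ n • weight (-γ) n • ψ n
  rw [smul_comm, weight_smul_weight_smul]

/-- The second resolvent identity, with the Birman–Schwinger operator factored out. -/
theorem resolvent_add_mul {E : Type*} [NormedAddCommGroup E] [NormedSpace ℂ E]
    {L X Y : E →L[ℂ] E} (hL : IsUnit L) :
    (IsUnit (L + L * X * Y) ↔ IsUnit (1 + Y * X)) ∧
      (IsUnit (1 + Y * X) → Ring.inverse (L + L * X * Y)
        = Ring.inverse L - X * Ring.inverse (1 + Y * X) * Y * Ring.inverse L) := by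
  have hfac : L + L * X * Y = L * (1 + X * Y) := by rw [mul_add, mul_one, mul_assoc]
  have hiff : IsUnit (L + L * X * Y) ↔ IsUnit (1 + X * Y) := by
    rw [hfac]
    obtain ⟨u, rfl⟩ := hL
    exact Units.isUnit_units_mul u _
  refine ⟨hiff.trans ⟨fun h => (isUnit_one_add_comp_comm Y X h).1,
    fun h => (isUnit_one_add_comp_comm X Y h).1⟩, fun h => ?_⟩
  rw [hfac, Ring.inverse_mul (.inl hL)]
  have := (isUnit_one_add_comp_comm X Y h).2
  change Ring.inverse (1 + X * Y) = 1 - X * (Ring.inverse (1 + Y * X) * Y) at this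
  rw [this, sub_mul, one_mul, ← mul_assoc]

variable [CompleteSpace H]

/-- The continuation, in the variable `w`, of `W_{-γ} (H_V - z)⁻¹ W_{-γ}`. -/
def continuedResolvent (γ : ℝ) (A B W : L2Z H →L[ℂ] L2Z H) (w : ℂ) : L2Z H →L[ℂ] L2Z H :=
  weightedFreeResolvent H γ w - weightedFreeResolvent H γ w * A * W *
    Ring.inverse (1 + birmanSchwinger γ A B W w) * B * weightedFreeResolvent H γ w

/-- With `ρ` the weight and `R₀` the free resolvent, `H_V - z = (H₀ - z)(1 + X Y)` for `X = R₀ A ρ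
W` and `Y = ρ B`. Commuting `ρ` with `A` and `B` gives `Y X = B (ρ R₀ ρ) A W`, which involves only
the weighted free resolvent and hence continues. -/
theorem perturbed_resolvent {γ : ℝ} (hγ : 0 < γ) {A B W : L2Z H →L[ℂ] L2Z H}
    (hA : Commute A (decayOp H hγ)) (hB : Commute B (decayOp H hγ)) {w : ℂ} (hw : w ∈ disk γ)
    (hw0 : w ≠ 0) (hw1 : ‖w‖ < 1) :
    (IsUnit (perturbedOp (A * (decayOp H hγ * W * decayOp H hγ) * B) - (2 - w - w⁻¹) • 1) ↔
        IsUnit (1 + birmanSchwinger γ A B W w)) ∧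
      (IsUnit (1 + birmanSchwinger γ A B W w) → decayOp H hγ * Ring.inverse
          (perturbedOp (A * (decayOp H hγ * W * decayOp H hγ) * B) - (2 - w - w⁻¹) • 1)
          * decayOp H hγ = continuedResolvent γ A B W w) := by
  obtain ⟨hL, -⟩ := freeOp_resolvent (H := H) hw0 hw1
  have hT := weightedFreeResolvent_eq (H := H) hγ hw hw0 hw1
  set z : ℂ := 2 - w - w⁻¹
  set L := freeOp H - z • 1 with hLdef
  set ρ := decayOp H hγ
  set T := weightedFreeResolvent H γ w with hTdef
  set R₀ := Ring.inverse L with hR₀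
  have hLR : L * R₀ = 1 := Ring.mul_inverse_cancel _ hL
  have e1 : perturbedOp (A * (ρ * W * ρ) * B) - z • 1
      = L + L * (R₀ * A * ρ * W) * (ρ * B) := by
    have : L * (R₀ * A * ρ * W) * (ρ * B) = (L * R₀) * (A * (ρ * W * ρ) * B) := by
      simp only [mul_assoc]
    rw [this, hLR, one_mul, perturbedOp, hLdef]
    abel
  have e2 : (ρ * B) * (R₀ * A * ρ * W) = birmanSchwinger γ A B W w := by
    rw [birmanSchwinger, ← hTdef, ← hT, ← hB.eq]
    have : B * ρ * (R₀ * A * ρ * W) = B * (ρ * R₀ * (A * ρ)) * W := by simp only [mul_assoc]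
    rw [this, hA.eq]
    simp only [mul_assoc]
  obtain ⟨h1, h2⟩ := resolvent_add_mul (X := R₀ * A * ρ * W) (Y := ρ * B) hL
  rw [e1]
  rw [e2] at h1 h2
  refine ⟨h1, fun h => ?_⟩
  rw [h2 h, continuedResolvent, ← hTdef, mul_sub, sub_mul, ← hR₀, hT]
  congr 1
  have : ρ * (R₀ * A * ρ * W * Ring.inverse (1 + birmanSchwinger γ A B W w) * (ρ * B) * R₀) * ρ
      = ρ * R₀ * (A * ρ) * W * Ring.inverse (1 + birmanSchwinger γ A B W w) * (ρ * B)
        * R₀ * ρ := by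
    simp only [mul_assoc]
  rw [this, hA.eq, ← hB.eq, ← hT]
  simp only [mul_assoc]

end Resolvent

/-! ### Extension of the resolvent and absence of poles near the threshold -/

section Resonances

variable {H : Type*} [NormedAddCommGroup H] [InnerProductSpace ℂ H] [CompleteSpace H]

theorem exists_isMeromorphicExtension {γ : ℝ} (hγ : 0 < γ) {ε : ℝ} (hε : 0 < ε)
    (hphase : ∀ l ∈ Metric.ball (0 : ℂ) ε,
      AnalyticAt ℂ phase l ∧ phase l ∈ disk γ ∧ (0 < l.im → ‖phase l‖ < 1))
    {V : L2Z H →L[ℂ] L2Z H} (hV : IsAdmissible γ hγ V) :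
    (∃ R, IsMeromorphicExtension γ hγ V ε R) ∧
      ∃ r₀ : ℝ, 0 < r₀ ∧ r₀ ≤ ε ∧ ∀ l ∈ puncturedDisk r₀, ¬ IsPoleOfExtension γ hγ V ε l := by
  obtain ⟨Γ₁, Γ₂, Λ₁, Λ₂, w, W₀, rfl, hW, h1, -, h2, -, -, hfin, C, -, hw⟩ := hV
  obtain ⟨W, rfl⟩ := exists_eq_decayOp_mul_mul_decayOp hγ hW hw
  have hA : Commute (tensorOp Γ₁ Λ₁) (decayOp H hγ) := tensorOp_mul_mulOp _ h1 Λ₁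
  have hB : Commute (tensorOp Γ₂ Λ₂) (decayOp H hγ) := tensorOp_mul_mulOp _ h2 Λ₂
  obtain ⟨hinv, hunit⟩ := meromorphicOn_inverse_one_add_birmanSchwinger hγ Γ₁ Γ₂ hfin W
  set A := tensorOp Γ₁ Λ₁
  set B := tensorOp Γ₂ Λ₂
  set V := A * (decayOp H hγ * W * decayOp H hγ) * B
  have h0 : (0 : ℂ) ∈ Metric.ball (0 : ℂ) ε := Metric.mem_ball_self hε
  have hQ : ∀ z ∈ disk γ, MeromorphicAt (continuedResolvent γ A B W) z := fun z hz => by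
    have hT := meromorphicOn_weightedFreeResolvent (H := H) hγ z hz
    exact hT.sub (MeromorphicAt.clm_comp (MeromorphicAt.clm_comp (MeromorphicAt.clm_comp
      (MeromorphicAt.clm_comp (MeromorphicAt.clm_comp hT (MeromorphicAt.const _ _))
        (MeromorphicAt.const _ _)) (hinv z hz)) (MeromorphicAt.const _ _)) hT)
  have hQ' : ∀ l ∈ Metric.ball (0 : ℂ) ε,
      MeromorphicAt (fun l => continuedResolvent γ A B W (phase l)) l := fun l hl =>
    (hQ _ (hphase l hl).2.1).comp_analyticAt (hphase l hl).1
  let Φ : (L2Z H →L[ℂ] L2Z H) →L[ℂ] (WeightedL2Z γ H →L[ℂ] WeightedL2Z (-γ) H) :=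
    ContinuousLinearMap.compL ℂ (WeightedL2Z γ H) (L2Z H) (WeightedL2Z (-γ) H)
      (unweightCLM H γ) ∘L
      (ContinuousLinearMap.compL ℂ (WeightedL2Z γ H) (L2Z H) (L2Z H)).flip (weightCLM H γ)
  let R : ℂ → WeightedL2Z γ H →L[ℂ] WeightedL2Z (-γ) H := fun l =>
    Φ (continuedResolvent γ A B W (phase l))
  have hres : ∀ l, l ^ 2 ∈ resolventSet ℂ (perturbedOp V)
      ↔ IsUnit (perturbedOp V - (2 - phase l - (phase l)⁻¹) • 1) := fun l => by
    rw [spectrum.mem_resolventSet_iff, Algebra.algebraMap_eq_smul_one, ← neg_sub, IsUnit.neg_iff,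
      two_sub_phase_sub_inv]
  have hunit_iff : ∀ l ∈ Metric.ball (0 : ℂ) ε, 0 < l.im →
      (l ^ 2 ∈ resolventSet ℂ (perturbedOp V) ↔
        IsUnit (1 + birmanSchwinger γ A B W (phase l))) := fun l hl him => by
    rw [hres]
    exact (perturbed_resolvent hγ hA hB (hphase l hl).2.1 (phase_ne_zero l)
      ((hphase l hl).2.2 him)).1
  have hR : IsMeromorphicExtension γ hγ V ε R := by
    refine ⟨fun l hl => meromorphicAt_clm_comp Φ (hQ' l hl.1), fun l hl him hmem => ?_⟩
    rw [weightedResolvent_eq, ← two_sub_phase_sub_inv, (perturbed_resolvent hγ hA hB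
      (hphase l hl.1).2.1 (phase_ne_zero l) ((hphase l hl.1).2.2 him)).2
      ((hunit_iff l hl.1 him).1 hmem)]
    rfl
  refine ⟨⟨R, hR⟩, ?_⟩
  -- Invertibility holds on a punctured neighbourhood of `w = 1`; it pulls back to `l` because
  -- `phase l ≠ 1` for `l ≠ 0`.
  have hgood : ∀ᶠ l in 𝓝[≠] (0 : ℂ), IsUnit (1 + birmanSchwinger γ A B W (phase l)) := by
    have ht : Tendsto phase (𝓝[≠] 0) (𝓝[≠] (phase 0)) := by
      refine tendsto_nhdsWithin_iff.2
        ⟨((hphase 0 h0).1.continuousAt.tendsto).mono_left nhdsWithin_le_nhds, ?_⟩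
      filter_upwards [self_mem_nhdsWithin] with l hl
      have : phase 0 = 1 := by rw [phase, halfPhase_zero, one_pow]
      rw [Set.mem_compl_singleton_iff, this]
      exact phase_ne_one hl
    exact ht.eventually (hunit _ (hphase 0 h0).2.1)
  -- The decisive step: meromorphy at `l = 0` itself gives analyticity at all nearby `l ≠ 0`.
  have hana := (hQ' 0 h0).eventually_analyticAt
  rw [eventually_nhdsWithin_iff, Metric.eventually_nhds_iff_ball] at hgood hana
  obtain ⟨δ₁, hδ₁, hgood⟩ := hgood
  obtain ⟨δ₂, hδ₂, hana⟩ := hana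
  refine ⟨min δ₂ ε, by positivity, min_le_right _ _, ?_⟩
  rintro l hl ⟨hlε, R', hR', hneg⟩
  -- An extension is prescribed only where `l ^ 2` lies in the resolvent set. On `U` this always
  -- holds, so `R'` and `R` both equal the true resolvent there.
  let U : Set ℂ := Metric.ball 0 (min δ₁ ε) ∩ {l | 0 < l.im}
  have hUo : IsOpen U := Metric.isOpen_ball.inter (isOpen_lt continuous_const Complex.continuous_im)
  have hUeq : ∀ l ∈ U, R' l = R l := fun l hl => by
    have hne : l ≠ 0 := by
      rintro rfl
      exact lt_irrefl (0 : ℝ) hl.2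
    have hlε : l ∈ Metric.ball (0 : ℂ) ε := Metric.ball_subset_ball (min_le_right _ _) hl.1
    have hmem : l ^ 2 ∈ resolventSet ℂ (perturbedOp V) := (hunit_iff l hlε hl.2).2
      (hgood l (Metric.ball_subset_ball (min_le_left _ _) hl.1) hne)
    rw [hR'.eq_resolvent l ⟨hlε, hne⟩ hl.2 hmem, hR.eq_resolvent l ⟨hlε, hne⟩ hl.2 hmem]
  have hm : 0 < min δ₁ ε := lt_min hδ₁ hε
  let a : ℂ := Complex.I * (min δ₁ ε / 2 : ℝ)
  have haU : a ∈ U := by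
    refine ⟨?_, ?_⟩
    · rw [mem_ball_zero_iff, norm_mul, Complex.norm_I, one_mul, Complex.norm_real,
        Real.norm_of_nonneg (by positivity)]
      exact half_lt_self hm
    · change 0 < a.im
      rw [Complex.I_mul_im, Complex.ofReal_re]
      positivity
  have haε : a ∈ puncturedDisk ε := by
    refine ⟨Metric.ball_subset_ball (min_le_right _ _) haU.1, ?_⟩
    rintro (h : a = 0)
    have := haU.2
    rw [h] at this
    exact lt_irrefl (0 : ℝ) this
  -- Identity theorem: the difference has infinite order at `a`, hence everywhere on the connected
  -- punctured disk, so `R'` has the same order as `R` at `l`.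
  have hD : MeromorphicOn (R' - R) (puncturedDisk ε) := hR'.meromorphicOn.sub hR.meromorphicOn
  have hatop : meromorphicOrderAt (R' - R) a = ⊤ := by
    rw [meromorphicOrderAt_eq_top_iff]
    refine Eventually.filter_mono nhdsWithin_le_nhds ?_
    filter_upwards [hUo.mem_nhds haU] with l hl
    rw [Pi.sub_apply, hUeq l hl, sub_self]
  have hltop : meromorphicOrderAt (R' - R) l = ⊤ := by
    by_contra h
    exact hD.meromorphicOrderAt_ne_top_of_isPreconnected (isPreconnected_puncturedDisk ε) hlε haε h
      hatop
  have heq : R' =ᶠ[𝓝[≠] l] R := by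
    rw [meromorphicOrderAt_eq_top_iff] at hltop
    filter_upwards [hltop] with z hz
    exact sub_eq_zero.1 hz
  rw [meromorphicOrderAt_congr heq] at hneg
  have hRa : AnalyticAt ℂ R l := (Φ.analyticAt _).comp
    (hana l (Metric.ball_subset_ball (min_le_left _ _) hl.1) hl.2)
  exact absurd hRa.meromorphicOrderAt_nonneg (not_le.2 hneg)

end Resonances

end DiscreteSchrodinger

end

theorem theorem2p3 {H : Type*} [NormedAddCommGroup H] [InnerProductSpace ℂ H] [CompleteSpace H]
    [TopologicalSpace.SeparableSpace H] (γ : ℝ) (hγ : 0 < γ) :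
    ∃ ε₀ : ℝ, 0 < ε₀ ∧ ε₀ ≤ γ / 8 ∧
      ∀ V : DiscreteSchrodinger.L2Z H →L[ℂ] DiscreteSchrodinger.L2Z H,
        DiscreteSchrodinger.IsAdmissible γ hγ V →
        ∀ μ : DiscreteSchrodinger.Threshold,
          (∃ R, DiscreteSchrodinger.IsMeromorphicExtension γ hγ (μ.perturbation V) ε₀ R) ∧
          ∃ r₀ : ℝ, 0 < r₀ ∧ r₀ ≤ ε₀ ∧
            ∀ r : ℝ, 0 < r → r < r₀ → ∀ l ∈ DiscreteSchrodinger.puncturedDisk r,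
              ¬ DiscreteSchrodinger.IsResonance γ hγ V ε₀ μ l := by
  -- `ε₀` is chosen before `V`; each threshold is then the case `0` for the admissible operator
  -- `μ.perturbation V`.
  obtain ⟨ε₀, hε₀, hle, hphase⟩ := DiscreteSchrodinger.exists_radius_phase hγ
  refine ⟨ε₀, hε₀, hle, fun V hV μ => ?_⟩
  obtain ⟨hR, r₀, hr₀, hr₀ε, hpole⟩ :=
    DiscreteSchrodinger.exists_isMeromorphicExtension hγ hε₀ hphase (hV.perturbation μ)
  exact ⟨hR, r₀, hr₀, hr₀ε, fun r _ hr l hl =>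
    hpole l ⟨Metric.ball_subset_ball hr.le hl.1, hl.2⟩⟩
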